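/- Let $\mathbb{H}$ be the quaternions, $\mathbb{S}$ the set of purely imaginary quaternions of norm $1$, and $\mathbb{C}_I=\{x+Iy:\ x,y\in\mathbb{R}\}$, with area measure $dm_I$, for $I\in\mathbb{S}$. Put $e^{It}=\cos t+I\sin t$. For $q\in\mathbb{H}\setminus\mathbb{R}$ let $I_q\in\mathbb{S}$ be the normalized imaginary part of $q$; for $q\in\mathbb{R}$ let $I_q$ be an arbitrary fixed element of $\mathbb{S}$. A function $f:\mathbb{H}\to\mathbb{H}$ is entire slice regular if it is real differentiable and $\left(\frac{\partial}{\partial x}+I\frac{\partial}{\partial y}\right)f(x+Iy)=0$ for all $I\in\mathbb{S}$ and $x,y\in\mathbb{R}$. For $1\le p<\infty$, $\alpha>0$ and $I\in\mathbb{S}$ let $$\|f\|_{p,\alpha,I}=\Big(\frac{\alpha p}{2\pi}\int_{\mathbb{C}_I}|f(q)|^p\,(e^{-\alpha|q|^2/2})^p\,dm_I(q)\Big)^{1/p},$$ and let $\mathcal{F}^{\alpha,p}_{Slice}(\mathbb{H})$ be the set of entire slice regular $f$ with $\|f\|_{p,\alpha,I}<\infty$ for some $I\in\mathbb{S}$.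 For $k,n\ge 1$ and $\delta>0$ put $$\omega_k(f;\delta)_{\mathcal{F}^p_{\alpha,I}}=\sup_{h\in\mathbb{R},\,|h|\le\delta}\Big(\int_{\mathbb{C}_I}\Big|\sum_{s=0}^k(-1)^{k+s}\binom ks f(ze^{Ish})\Big|^p\,(e^{-\alpha|z|^2/2})^p\,dm_I(z)\Big)^{1/p},$$ $$E_n(f)_{p,\alpha,I}=\inf_{P\in\mathcal{P}_n}\|f-P\|_{p,\alpha,I},$$ where $\mathcal{P}_d$ is the set of quaternionic polynomials $q\mapsto\sum_{k=0}^{d}q^ka_k$, $a_k\in\mathbb{H}$, of degree $\le d$. For integers $n,r\ge1$ and $m\ge0$ put $$F_n(f)(q)=\int_{-\pi}^{\pi}f(qe^{I_qt})\,\frac1{2\pi n}\Big(\frac{\sin(nt/2)}{\sin(t/2)}\Big)^2dt,\qquad V_n(f)=2F_{2n}(f)-F_n(f),$$ $$I_{n,m,r}(f)(q)=-\int_{-\pi}^{\pi}K_{n,r}(t)\sum_{k=1}^{m+1}(-1)^k\binom{m+1}k f(qe^{I_qkt})\,dt,\qquad K_{n,r}(t)=\frac1{\lambda_{n,r}}\Big(\frac{\sin(nt/2)}{\sin(t/2)}\Big)^{2r},$$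 with $\lambda_{n,r}$ chosen so that $\int_{-\pi}^{\pi}K_{n,r}(t)\,dt=1$. **Theorem 4.5.** Let $1\le p<\infty$. (i) Let $m\ge0$ be an integer and let $r$ be the smallest integer with $r\ge\frac{p(m+1)+2}{2}$. There is a constant $C_{p,m,r}>0$, depending only on $p,m,r$, such that for all $\alpha>0$, all $f\in\mathcal{F}^{\alpha,p}_{Slice}(\mathbb{H})$ and all integers $n\ge1$, $I_{n,m,r}(f)$ is a quaternionic polynomial of degree $\le r(n-1)$, and for every $I\in\mathbb{S}$ $$\|I_{n,m,r}(f)-f\|_{p,\alpha,I}\le C_{p,m,r}\Big(\frac{\alpha p}{2\pi}\Big)^{1/p}\,\omega_{m+1}\Big(f;\frac1n\Big)_{\mathcal{F}^p_{\alpha,I}}.$$ (ii) For all $\alpha>0$, all $f\in\mathcal{F}^{\alpha,p}_{Slice}(\mathbb{H})$ and all integers $n\ge1$, $V_n(f)$ is a quaternionic polynomial of degree $\le 2n-1$, and for every $I\in\mathbb{S}$ $$\|V_n(f)-f\|_{p,\alpha,I}\le\Big[2^{(p-1)/p}(2^p+1)^{1/p}+1\Big]\,E_n(f)_{p,\alpha,I}.$$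 -/

import Mathlib

open scoped Quaternion ENNReal

noncomputable section

namespace SliceFock

/-- The sphere `𝕊` of purely imaginary unit quaternions. -/
def imagSphere : Set ℍ[ℝ] := {q | q.re = 0 ∧ ‖q‖ = 1}

/-- The point `x + I y` of the complex plane `ℂ_I` that corresponds to `z = x + i y`. For `I ∈ 𝕊` this
is an isometry of `ℂ` onto `ℂ_I`, so the area measure of `ℂ_I` corresponds to `volume` on `ℂ`. -/
def slicePoint (I : ℍ[ℝ]) (z : ℂ) : ℍ[ℝ] := (z.re : ℍ[ℝ]) + I * (z.im : ℍ[ℝ])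

/-- `e^{I t} = cos t + I sin t`. -/
def expUnit (I : ℍ[ℝ]) (t : ℝ) : ℍ[ℝ] := (Real.cos t : ℍ[ℝ]) + I * (Real.sin t : ℍ[ℝ])

/-- The imaginary unit `I_q` of `q`: the normalized imaginary part when `q` is not real, and the
arbitrary fixed unit `I₀` when `q` is real. -/
def imagUnit (I₀ q : ℍ[ℝ]) : ℍ[ℝ] :=
  open Classical in if q.im = 0 then I₀ else (‖q.im‖⁻¹ : ℝ) • q.im

/-- Entire (left) slice regular functions: real differentiable on the quaternions, and on each
`ℂ_I` one has `(∂/∂x + I ∂/∂y) f_I (x + I y) = 0`; the partial derivatives of the restriction `f_I`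
are the derivatives of `f` in the directions `1` and `I`. -/
def SliceRegular (f : ℍ[ℝ] → ℍ[ℝ]) : Prop :=
  Differentiable ℝ f ∧ ∀ I ∈ imagSphere, ∀ z : ℂ,
    fderiv ℝ f (slicePoint I z) 1 + I * fderiv ℝ f (slicePoint I z) I = 0

/-- `∫ |g(z)|^p (e^{-α |z|² / 2})^p dA(z)` for `g` on a slice, in the coordinate `z = x + i y`. -/
def weightedIntegral (α p : ℝ) (g : ℂ → ℍ[ℝ]) : ℝ≥0∞ :=
  ∫⁻ z : ℂ, ‖g z‖ₑ ^ p * ENNReal.ofReal (Real.exp (-α * ‖z‖ ^ 2 / 2)) ^ p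

/-- `‖f‖_{p, α, I}`, with values in `[0, ∞]`. -/
def fockNorm (α p : ℝ) (I : ℍ[ℝ]) (f : ℍ[ℝ] → ℍ[ℝ]) : ℝ≥0∞ :=
  (ENNReal.ofReal (α * p / (2 * Real.pi)) *
    weightedIntegral α p (fun z => f (slicePoint I z))) ^ (1 / p)

/-- The slice regular Fock space of the second kind. -/
def fockSlice (α p : ℝ) : Set (ℍ[ℝ] → ℍ[ℝ]) :=
  {f | SliceRegular f ∧ ∃ I ∈ imagSphere, fockNorm α p I f < ⊤}

/-- The `k`-th rotational difference `∑_{s=0}^{k} (-1)^{k+s} (k choose s) f(q e^{I s h})`. -/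
def rotDiff (I : ℍ[ℝ]) (k : ℕ) (h : ℝ) (f : ℍ[ℝ] → ℍ[ℝ]) (q : ℍ[ℝ]) : ℍ[ℝ] :=
  ∑ s ∈ Finset.range (k + 1),
    ((-1 : ℝ) ^ (k + s) * (k.choose s : ℝ)) • f (q * expUnit I (s * h))

/-- The weighted `L^p` modulus of smoothness of order `k` on the slice `ℂ_I`. -/
def modulus (α p : ℝ) (I : ℍ[ℝ]) (k : ℕ) (f : ℍ[ℝ] → ℍ[ℝ]) (δ : ℝ) : ℝ≥0∞ :=
  ⨆ (h : ℝ) (_ : |h| ≤ δ),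
    weightedIntegral α p (fun z => rotDiff I k h f (slicePoint I z)) ^ (1 / p)

/-- Quaternionic polynomial functions `q ↦ ∑_{k ≤ d} q^k a_k`, of degree at most `d`, with the
coefficients on the right. -/
def polysDegreeLE (d : ℕ) : Set (ℍ[ℝ] → ℍ[ℝ]) :=
  {P | ∃ a : ℕ → ℍ[ℝ], ∀ q, P q = ∑ k ∈ Finset.range (d + 1), q ^ k * a k}

/-- The error `E_n(f)_{p, α, I}` of best approximation by polynomials of degree at most `n`. -/
def bestApprox (α p : ℝ) (I : ℍ[ℝ]) (n : ℕ) (f : ℍ[ℝ] → ℍ[ℝ]) : ℝ≥0∞ :=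
  ⨅ P ∈ polysDegreeLE n, fockNorm α p I (f - P)

/-- The Fejér kernel. -/
def fejerKernel (n : ℕ) (t : ℝ) : ℝ :=
  1 / (2 * Real.pi * n) * (Real.sin (n * t / 2) / Real.sin (t / 2)) ^ 2

/-- The constant `λ_{n, r}` that normalizes the generalized Jackson kernel. -/
def jacksonConst (n r : ℕ) : ℝ :=
  ∫ t in (-Real.pi)..Real.pi, (Real.sin (n * t / 2) / Real.sin (t / 2)) ^ (2 * r)

/-- The generalized Jackson kernel `K_{n, r}`. -/
def jacksonKernel (n r : ℕ) (t : ℝ) : ℝ :=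
  1 / jacksonConst n r * (Real.sin (n * t / 2) / Real.sin (t / 2)) ^ (2 * r)

/-- `F_n(f)(q) = ∫_{-π}^{π} f(q e^{I_q t}) K_n(t) dt` with the Fejér kernel `K_n`. -/
def fejerOp (I₀ : ℍ[ℝ]) (n : ℕ) (f : ℍ[ℝ] → ℍ[ℝ]) (q : ℍ[ℝ]) : ℍ[ℝ] :=
  ∫ t in (-Real.pi)..Real.pi, fejerKernel n t • f (q * expUnit (imagUnit I₀ q) t)

/-- `I_{n, m, r}(f)(q)
  = -∫_{-π}^{π} K_{n, r}(t) ∑_{k=1}^{m+1} (-1)^k (m+1 choose k) f(q e^{I_q k t}) dt`. -/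
def jacksonOp (I₀ : ℍ[ℝ]) (n m r : ℕ) (f : ℍ[ℝ] → ℍ[ℝ]) (q : ℍ[ℝ]) : ℍ[ℝ] :=
  -∫ t in (-Real.pi)..Real.pi, jacksonKernel n r t •
    ∑ k ∈ Finset.Icc 1 (m + 1),
      ((-1 : ℝ) ^ k * ((m + 1).choose k : ℝ)) • f (q * expUnit (imagUnit I₀ q) (k * t))

/-- `V_n(f) = 2 F_{2n}(f) - F_n(f)`. -/
def valleePoussinOp (I₀ : ℍ[ℝ]) (n : ℕ) (f : ℍ[ℝ] → ℍ[ℝ]) (q : ℍ[ℝ]) : ℍ[ℝ] :=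
  (2 : ℝ) • fejerOp I₀ (2 * n) f q - fejerOp I₀ n f q

end SliceFock

end

open SliceFock

/-!
An entire slice regular function is the sum on `ℍ` of one power series `∑ q^k a_k`: on a slice it is
a holomorphic function, and the Taylor coefficients of any two slices agree because both are read
off the real axis. Averaging the rotations `f (q e^{I_q t})` against an even kernel multiplies `a_j`
by the cosine moment of order `j` of the kernel. This makes the operators independent of the choice
of the unit on the slice and, as the kernels are polynomials in `cos t`, gives the degree bounds.

Rotations preserve the weighted `L^p` norm, so by Jensen's inequality averages of rotations are
contractions. Hence `V_n` has norm at most `3`; since it fixes the polynomials of degree at most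
`n`, its error is at most `4 E_n(f)`, and `3 ≤ 2^{(p-1)/p} (2^p + 1)^{1/p}` by convexity. For the
Jackson operator the error is an average of the differences of order `m + 1`, whose `L^p` norms are
at most `(1 + n |t|)^{m+1} ω_{m+1}(f; 1/n)`, and for `2 r ≥ p (m + 1) + 2` the corresponding moment
of the kernel is bounded independently of `n`.
-/

noncomputable section

namespace SliceFock

open Real MeasureTheory Filter
open scoped Polynomial

section Slices

variable {I : ℍ[ℝ]}

lemma mul_self_of_mem_imagSphere (hI : I ∈ imagSphere) : I * I = -1 := by
  have hstar : star I = -I := by ext <;> simp [hI.1]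
  have h := Quaternion.self_mul_star I
  rw [hstar, mul_neg, Quaternion.normSq_eq_norm_mul_self, hI.2] at h
  simpa using congrArg Neg.neg h

/-- The isomorphism of `ℂ` onto the slice `ℂ_I`, as a homomorphism of real algebras into `ℍ`. -/
def sliceHom (hI : I ∈ imagSphere) : ℂ →ₐ[ℝ] ℍ[ℝ] :=
  Complex.lift ⟨I, mul_self_of_mem_imagSphere hI⟩

lemma sliceHom_apply (hI : I ∈ imagSphere) (z : ℂ) : sliceHom hI z = slicePoint I z := by
  rw [sliceHom, Complex.lift_apply, Complex.liftAux_apply, slicePoint,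
    ← Quaternion.coe_mul_eq_smul, ← Quaternion.coe_commutes]
  rfl

lemma norm_slicePoint (hI : I ∈ imagSphere) (z : ℂ) : ‖slicePoint I z‖ = ‖z‖ := by
  have hre : I.re = 0 := hI.1
  have hsq : I.imI * I.imI + I.imJ * I.imJ + I.imK * I.imK = 1 := by
    have h := congrArg QuaternionAlgebra.re (mul_self_of_mem_imagSphere hI)
    simp only [Quaternion.re_mul, hre, Quaternion.re_neg, Quaternion.re_one] at h
    linarith
  have h : ‖slicePoint I z‖ * ‖slicePoint I z‖ = ‖z‖ * ‖z‖ := by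
    rw [← Quaternion.normSq_eq_norm_mul_self, Complex.norm_mul_self_eq_normSq,
      Quaternion.normSq_def', Complex.normSq_apply]
    simp only [slicePoint, Quaternion.re_add, Quaternion.re_coe, Quaternion.re_mul, hre, zero_mul,
      Quaternion.imI_coe, mul_zero, sub_self, Quaternion.imJ_coe, Quaternion.imK_coe, add_zero,
      Quaternion.imI_add, Quaternion.imI_mul, zero_add, sub_zero, Quaternion.imJ_add,
      Quaternion.imJ_mul, Quaternion.imK_add, Quaternion.imK_mul]
    linear_combination z.im * z.im * hsq
  exact (mul_self_inj (norm_nonneg _) (norm_nonneg _)).1 h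

lemma slicePoint_mul (hI : I ∈ imagSphere) (z w : ℂ) :
    slicePoint I (z * w) = slicePoint I z * slicePoint I w := by
  simp only [← sliceHom_apply hI, map_mul]

lemma slicePoint_pow (hI : I ∈ imagSphere) (z : ℂ) (n : ℕ) :
    slicePoint I (z ^ n) = slicePoint I z ^ n := by
  simp only [← sliceHom_apply hI, map_pow]

lemma slicePoint_ofReal (I : ℍ[ℝ]) (x : ℝ) : slicePoint I x = x := by
  simp [slicePoint]

lemma slicePoint_exp (I : ℍ[ℝ]) (t : ℝ) :
    slicePoint I (Complex.exp (t * Complex.I)) = expUnit I t := by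
  simp [slicePoint, expUnit, Complex.exp_ofReal_mul_I_re, Complex.exp_ofReal_mul_I_im]

lemma slicePoint_mul_expUnit (hI : I ∈ imagSphere) (z : ℂ) (t : ℝ) :
    slicePoint I z * expUnit I t = slicePoint I (z * Complex.exp (t * Complex.I)) := by
  rw [slicePoint_mul hI, slicePoint_exp]

lemma norm_expUnit (hI : I ∈ imagSphere) (t : ℝ) : ‖expUnit I t‖ = 1 := by
  rw [← slicePoint_exp, norm_slicePoint hI, Complex.norm_exp_ofReal_mul_I]

lemma continuous_slicePoint (I : ℍ[ℝ]) : Continuous (slicePoint I) :=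
  (Quaternion.continuous_coe.comp Complex.continuous_re).add
    (continuous_const.mul (Quaternion.continuous_coe.comp Complex.continuous_im))

lemma continuous_expUnit (I : ℍ[ℝ]) : Continuous (expUnit I) :=
  (Quaternion.continuous_coe.comp continuous_cos).add
    (continuous_const.mul (Quaternion.continuous_coe.comp continuous_sin))

lemma imagUnit_mem {I₀ : ℍ[ℝ]} (hI₀ : I₀ ∈ imagSphere) (q : ℍ[ℝ]) :
    imagUnit I₀ q ∈ imagSphere := by
  unfold imagUnit
  split_ifs with h
  · exact hI₀
  · refine ⟨by simp, ?_⟩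
    rw [norm_smul, norm_inv, norm_norm, inv_mul_cancel₀ (norm_ne_zero_iff.2 h)]

lemma exists_slicePoint_imagUnit (I₀ q : ℍ[ℝ]) : ∃ z, slicePoint (imagUnit I₀ q) z = q := by
  unfold imagUnit
  split_ifs with h
  · refine ⟨q.re, ?_⟩
    rw [slicePoint_ofReal, ← add_zero (q.re : ℍ[ℝ]), ← h, Quaternion.re_add_im]
  · refine ⟨⟨q.re, ‖q.im‖⟩, ?_⟩
    rw [slicePoint, ← Quaternion.coe_commutes, Quaternion.coe_mul_eq_smul, smul_smul,
      mul_inv_cancel₀ (norm_ne_zero_iff.2 h), one_smul, Quaternion.re_add_im]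

end Slices

section PowerSeries

/-- `f` is the sum, on all of `ℍ`, of the power series `∑ q^k a_k` with right coefficients. -/
def HasPowerSeries (a : ℕ → ℍ[ℝ]) (f : ℍ[ℝ] → ℍ[ℝ]) : Prop :=
  ∀ q, HasSum (fun k => q ^ k * a k) (f q)

variable {I I₀ : ℍ[ℝ]} {a b : ℕ → ℍ[ℝ]} {f g : ℍ[ℝ] → ℍ[ℝ]}

lemma SliceRegular.fderiv_slicePoint (hf : SliceRegular f) (hI : I ∈ imagSphere) (z w : ℂ) :
    fderiv ℝ f (slicePoint I z) (slicePoint I w)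
      = slicePoint I w * fderiv ℝ f (slicePoint I z) 1 := by
  have hderiv : fderiv ℝ f (slicePoint I z) I = I * fderiv ℝ f (slicePoint I z) 1 := by
    rw [eq_neg_of_add_eq_zero_left (hf.2 I hI z), mul_neg, ← mul_assoc,
      mul_self_of_mem_imagSphere hI, neg_one_mul, neg_neg]
  have hw : slicePoint I w = w.re • (1 : ℍ[ℝ]) + w.im • I := by
    rw [slicePoint, ← Quaternion.coe_commutes, Quaternion.coe_mul_eq_smul,
      ← Quaternion.coe_mul_eq_smul w.re, mul_one]
  rw [hw, map_add, map_smul, map_smul, hderiv, add_mul, smul_mul_assoc, smul_mul_assoc, one_mul]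

/-- The complex normed space structure on `ℍ` for which `z : ℂ` acts by left multiplication by the
corresponding element of `ℂ_I`: a slice regular function restricts to a holomorphic function with
values in this space. -/
@[reducible] def sliceNormedSpace (hI : I ∈ imagSphere) : NormedSpace ℂ ℍ[ℝ] :=
  { Module.compHom ℍ[ℝ] (sliceHom hI).toRingHom with
    norm_smul_le := fun c q => by
      change ‖sliceHom hI c * q‖ ≤ ‖c‖ * ‖q‖
      rw [sliceHom_apply, norm_mul, norm_slicePoint hI] }

lemma SliceRegular.exists_hasSum_slice (hf : SliceRegular f) (hI : I ∈ imagSphere) :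
    ∃ a : ℕ → ℍ[ℝ], ∀ z, HasSum (fun k => slicePoint I z ^ k * a k) (f (slicePoint I z)) := by
  let _ := sliceNormedSpace hI
  have smul_def (c : ℂ) (q : ℍ[ℝ]) : c • q = slicePoint I c * q := by
    rw [← sliceHom_apply hI]; rfl
  have : IsScalarTower ℝ ℂ ℍ[ℝ] := ⟨fun x c q => by
    rw [smul_def, smul_def, ← sliceHom_apply hI, ← sliceHom_apply hI, map_smul, smul_mul_assoc]⟩
  have hslice (z : ℂ) :
      HasFDerivAt (slicePoint I) (sliceHom hI).toLinearMap.toContinuousLinearMap z :=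
    (sliceHom hI).toLinearMap.toContinuousLinearMap.hasFDerivAt.congr_of_eventuallyEq
      (.of_forall fun w => (sliceHom_apply hI w).symm)
  have holomorphic : Differentiable ℂ fun z => f (slicePoint I z) := fun z =>
    (hasFDerivAt_of_restrictScalars ℝ ((hf.1 _).hasFDerivAt.comp z (hslice z))
      (f' := ContinuousLinearMap.toSpanSingleton ℂ (fderiv ℝ f (slicePoint I z) 1))
      (ContinuousLinearMap.ext fun w => by
        change w • _ = fderiv ℝ f (slicePoint I z) (sliceHom hI w)
        rw [smul_def, sliceHom_apply, hf.fderiv_slicePoint hI])).differentiableAt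
  refine ⟨fun k => (((k.factorial : ℝ)⁻¹ : ℝ) : ℍ[ℝ]) *
    iteratedDeriv k (fun z => f (slicePoint I z)) 0, fun z => ?_⟩
  convert Complex.hasSum_taylorSeries_of_entire holomorphic 0 z using 2 with k
  · rfl
  rw [sub_zero, smul_def, smul_def, ← Complex.ofReal_natCast, ← Complex.ofReal_inv,
    slicePoint_ofReal, slicePoint_pow hI, ← mul_assoc, ← mul_assoc, Quaternion.coe_commutes]

/-- The coefficients are determined by the values on the real axis, which lies on every slice. -/
lemma coeff_unique {u : ℝ → ℍ[ℝ]} (ha : ∀ x : ℝ, HasSum (fun k => (x : ℍ[ℝ]) ^ k * a k) (u x))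
    (hb : ∀ x : ℝ, HasSum (fun k => (x : ℍ[ℝ]) ^ k * b k) (u x)) : a = b := by
  have hseries (c : ℕ → ℍ[ℝ]) (hc : ∀ x : ℝ, HasSum (fun k => (x : ℍ[ℝ]) ^ k * c k) (u x)) :
      HasFPowerSeriesAt u (fun n => ContinuousMultilinearMap.mkPiRing ℝ (Fin n) (c n)) 0 := by
    refine hasFPowerSeriesAt_iff.2 (.of_forall fun x => ?_)
    rw [zero_add]
    convert hc x using 2 with k
    · rfl
    rw [← Quaternion.coe_pow, Quaternion.coe_mul_eq_smul]
    simp [FormalMultilinearSeries.coeff]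
  funext n
  simpa [FormalMultilinearSeries.coeff] using
    congrArg (·.coeff n) ((hseries a ha).eq_formalMultilinearSeries (hseries b hb))

theorem SliceRegular.exists_hasPowerSeries (hf : SliceRegular f) (hI₀ : I₀ ∈ imagSphere) :
    ∃ a, HasPowerSeries a f := by
  obtain ⟨a, ha⟩ := hf.exists_hasSum_slice hI₀
  refine ⟨a, fun q => ?_⟩
  obtain ⟨b, hb⟩ := hf.exists_hasSum_slice (imagUnit_mem hI₀ q)
  obtain ⟨z, hz⟩ := exists_slicePoint_imagUnit I₀ q
  have hab : a = b := coeff_unique (u := fun x => f x)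
    (fun x => by simpa only [slicePoint_ofReal] using ha x)
    (fun x => by simpa only [slicePoint_ofReal] using hb x)
  simpa only [hz, hab] using hb z

lemma HasPowerSeries.unique (hf : HasPowerSeries a f) (hg : HasPowerSeries a g) : f = g :=
  funext fun q => (hf q).unique (hg q)

lemma HasPowerSeries.sub (hf : HasPowerSeries a f) (hg : HasPowerSeries b g) :
    HasPowerSeries (a - b) (f - g) := fun q => by
  simpa only [Pi.sub_apply, mul_sub] using (hf q).sub (hg q)

lemma HasPowerSeries.summable_norm (hf : HasPowerSeries a f) (R : ℝ) :
    Summable fun k => |R| ^ k * ‖a k‖ := by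
  simpa only [norm_mul, norm_pow, Quaternion.norm_coe, Real.norm_eq_abs] using
    (hf (R : ℍ[ℝ])).summable.norm

lemma HasPowerSeries.continuous (hf : HasPowerSeries a f) : Continuous f := by
  refine continuous_iff_continuousAt.2 fun q => ?_
  have hball : ContinuousOn (fun x => ∑' k, x ^ k * a k) (Metric.ball 0 (‖q‖ + 1)) :=
    continuousOn_tsum (fun k => (by fun_prop)) (hf.summable_norm (‖q‖ + 1)) fun k x hx => by
      rw [norm_mul, norm_pow]
      gcongr
      exact (mem_ball_zero_iff.1 hx).le.trans (le_abs_self _)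
  rw [show f = fun x => ∑' k, x ^ k * a k from funext fun x => (hf x).tsum_eq.symm]
  exact hball.continuousAt (Metric.isOpen_ball.mem_nhds (by simp))

lemma HasPowerSeries.mem_polysDegreeLE {d : ℕ} (hf : HasPowerSeries a f)
    (ha : ∀ j, d < j → a j = 0) : f ∈ polysDegreeLE d :=
  ⟨a, fun q => (hf q).unique (hasSum_sum_of_ne_finset_zero fun j hj => by
    rw [ha j (by simpa using hj), mul_zero])⟩

lemma exists_hasPowerSeries_of_mem_polysDegreeLE {d : ℕ} (hf : f ∈ polysDegreeLE d) :
    ∃ a, HasPowerSeries a f ∧ ∀ j, d < j → a j = 0 := by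
  obtain ⟨a, ha⟩ := hf
  refine ⟨fun j => if j ≤ d then a j else 0, fun q => ?_, fun j hj => if_neg hj.not_ge⟩
  have hsum : f q = ∑ k ∈ Finset.range (d + 1), q ^ k * if k ≤ d then a k else 0 :=
    (ha q).trans (Finset.sum_congr rfl fun k hk => by
      rw [if_pos (Finset.mem_range_succ_iff.1 hk)])
  exact hsum ▸ hasSum_sum_of_ne_finset_zero fun j hj => by
    simp only [if_neg (mt Finset.mem_range_succ_iff.2 hj), mul_zero]

end PowerSeries

section RotationMeans

/-- The cosine moments `∫_{-π}^{π} κ(t) cos(j t) dt` of a kernel. -/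
def cosMoment (κ : ℝ → ℝ) (j : ℕ) : ℝ := ∫ t in (-π)..π, κ t * cos (j * t)

/-- The mean `∫_{-π}^{π} κ(t) f(q e^{I k t}) dt` of the rotations of `f` on the slice `ℂ_I`. The
operators of the theorem are combinations of such means with `I = I_q`. -/
def rotationMean (κ : ℝ → ℝ) (k : ℕ) (I : ℍ[ℝ]) (f : ℍ[ℝ] → ℍ[ℝ]) (q : ℍ[ℝ]) : ℍ[ℝ] :=
  ∫ t in (-π)..π, κ t • f (q * expUnit I (k * t))

variable {I I₀ q : ℍ[ℝ]} {κ : ℝ → ℝ} {a : ℕ → ℍ[ℝ]} {f : ℍ[ℝ] → ℍ[ℝ]}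

lemma integral_eq_zero_of_odd {E : Type*} [NormedAddCommGroup E] [NormedSpace ℝ E] {g : ℝ → E}
    (hg : Function.Odd g) (c : ℝ) : ∫ t in (-c)..c, g t = 0 := by
  have h := intervalIntegral.integral_comp_neg (a := -c) (b := c) g
  simp only [hg _, neg_neg, intervalIntegral.integral_neg] at h
  have : IsAddTorsionFree E := .of_isTorsionFree ℝ E
  exact self_eq_neg.1 h.symm

lemma integral_smul_expUnit_mul (hκ : IntervalIntegrable κ volume (-π) π)
    (heven : Function.Even κ) (I b : ℍ[ℝ]) (j : ℕ) :
    ∫ t in (-π)..π, κ t • (expUnit I (j * t) * b) = cosMoment κ j • b := by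
  have hcos : IntervalIntegrable (fun t => κ t * cos (j * t)) volume (-π) π :=
    hκ.mul_continuousOn (by fun_prop)
  have hsin : IntervalIntegrable (fun t => κ t * sin (j * t)) volume (-π) π :=
    hκ.mul_continuousOn (by fun_prop)
  have hodd : Function.Odd fun t => κ t * sin (j * t) := fun t => by
    simp only [heven t, mul_neg, sin_neg]
  have hsplit (t : ℝ) : κ t • (expUnit I (j * t) * b)
      = (κ t * cos (j * t)) • b + (κ t * sin (j * t)) • (I * b) := by
    simp only [expUnit, add_mul, ← Quaternion.coe_commutes, Quaternion.coe_mul_eq_smul, smul_add,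
      smul_mul_assoc, smul_smul]
  simp only [hsplit]
  rw [intervalIntegral.integral_add (hcos.smul_continuousOn continuousOn_const)
    (hsin.smul_continuousOn continuousOn_const), intervalIntegral.integral_smul_const,
    intervalIntegral.integral_smul_const, integral_eq_zero_of_odd hodd, zero_smul, add_zero,
    cosMoment]

lemma mul_expUnit_pow (hI : I ∈ imagSphere) (hq : q ∈ Set.range (slicePoint I)) (t : ℝ) (j : ℕ) :
    (q * expUnit I t) ^ j = q ^ j * expUnit I (j * t) := by
  obtain ⟨z, rfl⟩ := hq
  rw [slicePoint_mul_expUnit hI, ← slicePoint_pow hI, mul_pow, slicePoint_mul hI, slicePoint_pow hI,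
    ← slicePoint_exp, ← Complex.exp_nat_mul]
  push_cast
  rw [mul_assoc]

/-- Taking rotation means against an even kernel multiplies the coefficients of the power series by
the cosine moments of the kernel. -/
lemma HasPowerSeries.hasSum_rotationMean (hf : HasPowerSeries a f)
    (hκ : IntervalIntegrable κ volume (-π) π) (heven : Function.Even κ) (k : ℕ)
    (hI : I ∈ imagSphere) (hq : q ∈ Set.range (slicePoint I)) :
    HasSum (fun j => q ^ j * (cosMoment κ (j * k) • a j)) (rotationMean κ k I f q) := by
  have hterm (j : ℕ) (t : ℝ) : κ t • ((q * expUnit I (k * t)) ^ j * a j)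
      = q ^ j * κ t • (expUnit I ((j * k : ℕ) * t) * a j) := by
    rw [mul_expUnit_pow hI hq, mul_smul_comm, mul_assoc, Nat.cast_mul, mul_assoc (j : ℝ)]
  have hexp : Continuous (expUnit I) := continuous_expUnit I
  have hnorm (t : ℝ) : ‖q * expUnit I t‖ = |‖q‖| := by
    rw [norm_mul, norm_expUnit hI, mul_one, abs_norm]
  have hsum := hf.summable_norm ‖q‖
  have h := intervalIntegral.hasSum_integral_of_dominated_convergence (μ := volume)
    (F := fun (j : ℕ) t => κ t • ((q * expUnit I (k * t)) ^ j * a j))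
    (fun j t => |κ t| * (|‖q‖| ^ j * ‖a j‖))
    (fun j => hκ.def'.aestronglyMeasurable.smul (Continuous.aestronglyMeasurable (by fun_prop)))
    (fun j => .of_forall fun t _ => by
      rw [norm_smul, norm_mul, norm_pow, hnorm, Real.norm_eq_abs])
    (.of_forall fun t _ => hsum.mul_left _)
    (by simpa only [tsum_mul_left] using hκ.abs.mul_const _)
    (.of_forall fun t _ => (hf (q * expUnit I (k * t))).const_smul (κ t))
  simp only [hterm] at h
  simp only [intervalIntegral.integral_const_mul, integral_smul_expUnit_mul hκ heven] at h
  exact h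

lemma HasPowerSeries.rotationMean_imagUnit (hf : HasPowerSeries a f)
    (hκ : IntervalIntegrable κ volume (-π) π) (heven : Function.Even κ) (k : ℕ)
    (hI₀ : I₀ ∈ imagSphere) :
    HasPowerSeries (fun j => cosMoment κ (j * k) • a j)
      fun q => rotationMean κ k (imagUnit I₀ q) f q := fun q =>
  hf.hasSum_rotationMean hκ heven k (imagUnit_mem hI₀ q) (exists_slicePoint_imagUnit I₀ q)

lemma HasPowerSeries.rotationMean_imagUnit_eq (hf : HasPowerSeries a f)
    (hκ : IntervalIntegrable κ volume (-π) π) (heven : Function.Even κ) (k : ℕ)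
    (hI₀ : I₀ ∈ imagSphere) (hI : I ∈ imagSphere) (hq : q ∈ Set.range (slicePoint I)) :
    rotationMean κ k (imagUnit I₀ q) f q = rotationMean κ k I f q :=
  (hf.rotationMean_imagUnit hκ heven k hI₀ q).unique (hf.hasSum_rotationMean hκ heven k hI hq)

end RotationMeans

section Kernels

/-- A nonnegative even weight on `[-π, π]` of total mass one. -/
structure IsAveragingKernel (κ : ℝ → ℝ) : Prop where
  measurable : Measurable κ
  nonneg : 0 ≤ κ
  even : Function.Even κ
  integral_eq_one : ∫ t in (-π)..π, κ t = 1

lemma IsAveragingKernel.intervalIntegrable {κ : ℝ → ℝ} (hκ : IsAveragingKernel κ) :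
    IntervalIntegrable κ volume (-π) π :=
  intervalIntegral.intervalIntegrable_of_integral_ne_zero (by simp [hκ.integral_eq_one])

lemma cosMoment_const_mul (c : ℝ) (κ : ℝ → ℝ) (j : ℕ) :
    cosMoment (fun t => c * κ t) j = c * cosMoment κ j := by
  simp only [cosMoment, mul_assoc, intervalIntegral.integral_const_mul]

lemma integral_cos_nat_mul {j : ℕ} (hj : j ≠ 0) : ∫ t in (-π)..π, cos (j * t) = 0 := by
  rw [intervalIntegral.integral_comp_mul_left _ (Nat.cast_ne_zero.2 hj), integral_cos]
  simp [sin_nat_mul_pi]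

lemma integral_cos_pow_mul_cos {i j : ℕ} (hij : i < j) :
    ∫ t in (-π)..π, cos t ^ i * cos (j * t) = 0 := by
  induction i generalizing j with
  | zero => simpa using integral_cos_nat_mul hij.ne'
  | succ i ih =>
    obtain ⟨j, rfl⟩ := Nat.exists_eq_succ_of_ne_zero (Nat.ne_zero_of_lt hij)
    have hstep (t : ℝ) : cos t ^ (i + 1) * cos ((j + 1 : ℕ) * t)
        = 2⁻¹ * (cos t ^ i * cos ((j + 2 : ℕ) * t) + cos t ^ i * cos (j * t)) := by
      have h := two_mul_cos_mul_cos ((j + 1 : ℕ) * t) t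
      push_cast at h ⊢
      rw [show (j + 1) * t + t = (j + 2) * t by ring, show (j + 1) * t - t = j * t by ring] at h
      linear_combination cos t ^ i * h / 2
    simp only [Nat.succ_eq_add_one, hstep]
    rw [intervalIntegral.integral_const_mul,
      intervalIntegral.integral_add (Continuous.intervalIntegrable (by fun_prop) _ _)
        (Continuous.intervalIntegrable (by fun_prop) _ _), ih (by lia), ih (by lia)]
    simp

lemma integral_eval_cos_mul_cos {P : ℝ[X]} {j : ℕ} (hP : P.natDegree < j) :
    ∫ t in (-π)..π, P.eval (cos t) * cos (j * t) = 0 := by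
  simp only [Polynomial.eval_eq_sum_range, Finset.sum_mul, mul_assoc]
  rw [intervalIntegral.integral_finsetSum fun i _ =>
    Continuous.intervalIntegrable (by fun_prop) _ _]
  refine Finset.sum_eq_zero fun i hi => ?_
  rw [intervalIntegral.integral_const_mul,
    integral_cos_pow_mul_cos ((Finset.mem_range_succ_iff.1 hi).trans_lt hP), mul_zero]

lemma integral_cos_mul_cos_of_lt {i j : ℕ} (hij : i < j) :
    ∫ t in (-π)..π, cos (i * t) * cos (j * t) = 0 := by
  have h := integral_eval_cos_mul_cos (P := Polynomial.Chebyshev.T ℝ i) (j := j)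
    (by simpa [Polynomial.Chebyshev.natDegree_T] using hij)
  simpa only [Polynomial.Chebyshev.T_real_cos, Int.cast_natCast] using h

lemma integral_cos_mul_cos_self {j : ℕ} (hj : j ≠ 0) :
    ∫ t in (-π)..π, cos (j * t) * cos (j * t) = π := by
  have hsq (t : ℝ) : cos (j * t) * cos (j * t) = 2⁻¹ * cos ((2 * j : ℕ) * t) + 2⁻¹ := by
    push_cast
    rw [mul_assoc 2, cos_two_mul]
    ring
  simp only [hsq]
  rw [intervalIntegral.integral_add (Continuous.intervalIntegrable (by fun_prop) _ _)
    (by simp), intervalIntegral.integral_const_mul, integral_cos_nat_mul (by lia)]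
  simp
  ring

/-- The polynomial `P` of degree `n - 1` with `P (cos t) = (sin (n t / 2) / sin (t / 2))²`: as
`1 - cos s = 2 sin² (s / 2)`, it is `(1 - T_n) / (1 - X)` for the Chebyshev polynomial `T_n`. -/
def fejerPoly (n : ℕ) : ℝ[X] := (Polynomial.Chebyshev.T ℝ n - 1) /ₘ (Polynomial.X - Polynomial.C 1)

lemma natDegree_fejerPoly_le (n : ℕ) : (fejerPoly n).natDegree ≤ n - 1 := by
  rw [fejerPoly, Polynomial.natDegree_divByMonic _ (Polynomial.monic_X_sub_C 1),
    Polynomial.natDegree_X_sub_C, ← Polynomial.C_1, Polynomial.natDegree_sub_C,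
    Polynomial.Chebyshev.natDegree_T, Int.natAbs_natCast]

lemma cos_sub_one_mul_eval_fejerPoly (n : ℕ) (t : ℝ) :
    (cos t - 1) * (fejerPoly n).eval (cos t) = cos (n * t) - 1 := by
  have hroot : (Polynomial.Chebyshev.T ℝ n - 1).IsRoot 1 := by
    simp [Polynomial.Chebyshev.T_eval_one]
  simpa [fejerPoly, Polynomial.Chebyshev.T_real_cos] using
    congrArg (Polynomial.eval (cos t)) (Polynomial.mul_divByMonic_eq_iff_isRoot.2 hroot)

lemma ae_sin_half_ne_zero : ∀ᵐ t : ℝ, sin (t / 2) ≠ 0 := by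
  have hcountable : {t : ℝ | sin (t / 2) = 0}.Countable :=
    (Set.countable_range fun k : ℤ => 2 * (k * π)).mono fun t ht => by
      obtain ⟨k, hk⟩ := sin_eq_zero_iff.1 ht
      exact ⟨k, by simp only [hk]; ring⟩
  exact hcountable.ae_notMem volume

lemma sq_sin_div_sin_ae_eq (n : ℕ) : (fun t => (sin (n * t / 2) / sin (t / 2)) ^ 2)
    =ᵐ[volume] fun t => (fejerPoly n).eval (cos t) := by
  filter_upwards [ae_sin_half_ne_zero] with t ht
  have hsq (s : ℝ) : sin (s / 2) ^ 2 = (1 - cos s) / 2 := by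
    rw [sin_sq_eq_half_sub, mul_div_cancel₀ s two_ne_zero]; ring
  rw [div_pow, div_eq_iff (pow_ne_zero 2 ht), hsq, hsq]
  linear_combination cos_sub_one_mul_eval_fejerPoly n t / 2

lemma sin_div_sin_pow_ae_eq (n r : ℕ) : (fun t => (sin (n * t / 2) / sin (t / 2)) ^ (2 * r))
    =ᵐ[volume] fun t => (fejerPoly n ^ r).eval (cos t) := by
  filter_upwards [sq_sin_div_sin_ae_eq n] with t ht
  rw [pow_mul, ht, Polynomial.eval_pow]

lemma intervalIntegrable_sin_div_sin_pow (n r : ℕ) (b c : ℝ) :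
    IntervalIntegrable (fun t => (sin (n * t / 2) / sin (t / 2)) ^ (2 * r)) volume b c :=
  ((fejerPoly n ^ r).continuous.comp continuous_cos).intervalIntegrable b c |>.congr_ae
    (ae_restrict_of_ae (sin_div_sin_pow_ae_eq n r).symm)

lemma cosMoment_sin_div_sin_pow (n r j : ℕ) :
    cosMoment (fun t => (sin (n * t / 2) / sin (t / 2)) ^ (2 * r)) j
      = ∫ t in (-π)..π, (fejerPoly n ^ r).eval (cos t) * cos (j * t) :=
  intervalIntegral.integral_congr_ae <| by
    filter_upwards [sin_div_sin_pow_ae_eq n r] with t ht _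
    rw [ht]

lemma cosMoment_jacksonKernel_eq_zero {n r j : ℕ} (hj : r * (n - 1) < j) :
    cosMoment (jacksonKernel n r) j = 0 := by
  have hdegree : (fejerPoly n ^ r).natDegree < j :=
    (Polynomial.natDegree_pow_le_of_le r (natDegree_fejerPoly_le n)).trans_lt hj
  unfold jacksonKernel
  rw [cosMoment_const_mul, cosMoment_sin_div_sin_pow, integral_eval_cos_mul_cos hdegree, mul_zero]

/-- Multiplying `P_n (cos t)` by `2 (cos t - 1)` turns into a second difference of moments. -/
lemma integral_fejerPoly_second_difference (n j : ℕ) :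
    (∫ t in (-π)..π, (fejerPoly n).eval (cos t) * cos ((j + 2 : ℕ) * t))
      - 2 * (∫ t in (-π)..π, (fejerPoly n).eval (cos t) * cos ((j + 1 : ℕ) * t))
      + ∫ t in (-π)..π, (fejerPoly n).eval (cos t) * cos (j * t)
      = 2 * ∫ t in (-π)..π, cos (n * t) * cos ((j + 1 : ℕ) * t) := by
  have hpoint (t : ℝ) : (fejerPoly n).eval (cos t) * cos ((j + 2 : ℕ) * t)
      - 2 * ((fejerPoly n).eval (cos t) * cos ((j + 1 : ℕ) * t))
      + (fejerPoly n).eval (cos t) * cos (j * t)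
      = 2 * (cos (n * t) * cos ((j + 1 : ℕ) * t)) - 2 * cos ((j + 1 : ℕ) * t) := by
    have h := two_mul_cos_mul_cos ((j + 1 : ℕ) * t) t
    push_cast at h ⊢
    rw [show (j + 1) * t + t = (j + 2) * t by ring, show (j + 1) * t - t = j * t by ring] at h
    linear_combination 2 * cos ((j + 1) * t) * cos_sub_one_mul_eval_fejerPoly n t -
      (fejerPoly n).eval (cos t) * h
  have hint (k : ℕ) : IntervalIntegrable (fun t => (fejerPoly n).eval (cos t) * cos (k * t))
      volume (-π) π :=
    (((fejerPoly n).continuous.comp continuous_cos).intervalIntegrable _ _).mul_continuousOn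
      (by fun_prop)
  rw [← intervalIntegral.integral_const_mul, ← intervalIntegral.integral_sub (hint _)
    ((hint _).const_mul 2), ← intervalIntegral.integral_add
    ((hint _).sub ((hint _).const_mul 2)) (hint _)]
  simp only [hpoint]
  rw [intervalIntegral.integral_sub (Continuous.intervalIntegrable (by fun_prop) _ _)
    (Continuous.intervalIntegrable (by fun_prop) _ _), intervalIntegral.integral_const_mul,
    intervalIntegral.integral_const_mul, integral_cos_nat_mul j.succ_ne_zero, mul_zero, sub_zero]

lemma integral_fejerPoly_mul_cos_add {n : ℕ} (hn : n ≠ 0) (i j : ℕ) (hij : j + i = n) :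
    ∫ t in (-π)..π, (fejerPoly n).eval (cos t) * cos (j * t) = 2 * π * i := by
  have hvanish {k : ℕ} (hk : n ≤ k) :
      ∫ t in (-π)..π, (fejerPoly n).eval (cos t) * cos (k * t) = 0 :=
    integral_eval_cos_mul_cos ((natDegree_fejerPoly_le n).trans_lt (by lia))
  induction i using Nat.twoStepInduction generalizing j with
  | zero => simpa using hvanish hij.ge
  | one =>
    have h := integral_fejerPoly_second_difference n j
    rw [hvanish (by lia), hvanish (by lia), hij, integral_cos_mul_cos_self hn] at h
    push_cast
    linarith
  | more i ih₀ ih₁ =>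
    have h := integral_fejerPoly_second_difference n j
    rw [ih₀ (j + 2) (by lia), ih₁ (j + 1) (by lia)] at h
    simp only [mul_comm (cos (n * _))] at h
    rw [integral_cos_mul_cos_of_lt (by lia)] at h
    push_cast at h ⊢
    linarith

/-- The truncated subtraction makes the moments of order `j ≥ n` vanish. -/
lemma cosMoment_fejerKernel {n : ℕ} (hn : n ≠ 0) (j : ℕ) :
    cosMoment (fejerKernel n) j = ((n - j : ℕ) : ℝ) / n := by
  have hmoment : ∫ t in (-π)..π, (fejerPoly n).eval (cos t) * cos (j * t)
      = 2 * π * (n - j : ℕ) := by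
    rcases le_total j n with hj | hj
    · exact integral_fejerPoly_mul_cos_add hn (n - j) j (by lia)
    · rw [integral_eval_cos_mul_cos ((natDegree_fejerPoly_le n).trans_lt (by lia)),
        Nat.sub_eq_zero_of_le hj, Nat.cast_zero, mul_zero]
  have h := cosMoment_sin_div_sin_pow n 1 j
  rw [mul_one, pow_one, hmoment] at h
  unfold fejerKernel
  rw [cosMoment_const_mul, h]
  have : (n : ℝ) ≠ 0 := Nat.cast_ne_zero.2 hn
  field_simp

lemma isAveragingKernel_fejerKernel {n : ℕ} (hn : n ≠ 0) : IsAveragingKernel (fejerKernel n) where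
  measurable := by unfold fejerKernel; fun_prop
  nonneg t := by unfold fejerKernel; have := pi_pos; positivity
  even t := by simp only [fejerKernel, mul_neg, neg_div, sin_neg, div_neg, neg_neg]
  integral_eq_one := by
    simpa [cosMoment, hn] using cosMoment_fejerKernel hn 0

lemma two_mul_div_pi_le_sin_div_sin {n : ℕ} (hn : n ≠ 0) {t : ℝ} (h0 : 0 < t) (ht : t ≤ π / n) :
    2 * n / π ≤ sin (n * t / 2) / sin (t / 2) := by
  have hn1 : (1 : ℝ) ≤ n := Nat.one_le_cast.2 (Nat.one_le_iff_ne_zero.2 hn)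
  have hnt : n * t ≤ π := by rwa [mul_comm, ← le_div_iff₀ (by positivity)]
  have htπ : t ≤ π := by nlinarith
  rw [le_div_iff₀ (sin_pos_of_pos_of_lt_pi (by positivity) (by linarith [pi_pos]))]
  calc 2 * n / π * sin (t / 2) ≤ 2 * n / π * (t / 2) := by
        gcongr; exact sin_le (by positivity)
    _ = 2 / π * (n * t / 2) := by ring
    _ ≤ sin (n * t / 2) := mul_le_sin (by positivity) (by linarith)

lemma le_jacksonConst {n : ℕ} (hn : n ≠ 0) (r : ℕ) :
    (2 * n / π) ^ (2 * r) * (π / n) ≤ jacksonConst n r := by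
  have hn1 : (1 : ℝ) ≤ n := Nat.one_le_cast.2 (Nat.one_le_iff_ne_zero.2 hn)
  have hpos : 0 < π / n := by positivity
  have hle : π / n ≤ π := div_le_self pi_pos.le hn1
  calc (2 * n / π) ^ (2 * r) * (π / n) = ∫ t in (0 : ℝ)..(π / n), (2 * n / π) ^ (2 * r) := by
        simp [mul_comm]
    _ ≤ ∫ t in (0 : ℝ)..(π / n), (sin (n * t / 2) / sin (t / 2)) ^ (2 * r) :=
        intervalIntegral.integral_mono_on_of_le_Ioo hpos.le (by simp)
          (intervalIntegrable_sin_div_sin_pow n r _ _) fun t ht =>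
            pow_le_pow_left₀ (by positivity) (two_mul_div_pi_le_sin_div_sin hn ht.1 ht.2.le) _
    _ ≤ jacksonConst n r :=
        intervalIntegral.integral_mono_interval (by linarith [pi_pos]) hpos.le hle
          (.of_forall fun t => (even_two_mul r).pow_nonneg _)
          (intervalIntegrable_sin_div_sin_pow n r _ _)

lemma jacksonConst_pos {n : ℕ} (hn : n ≠ 0) (r : ℕ) : 0 < jacksonConst n r :=
  lt_of_lt_of_le (by positivity) (le_jacksonConst hn r)

lemma isAveragingKernel_jacksonKernel {n : ℕ} (hn : n ≠ 0) (r : ℕ) :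
    IsAveragingKernel (jacksonKernel n r) where
  measurable := by unfold jacksonKernel; fun_prop
  nonneg t := mul_nonneg (one_div_nonneg.2 (jacksonConst_pos hn r).le)
    ((even_two_mul r).pow_nonneg _)
  even t := by simp only [jacksonKernel, mul_neg, neg_div, sin_neg, div_neg, neg_neg]
  integral_eq_one := by
    unfold jacksonKernel
    rw [intervalIntegral.integral_const_mul, ← jacksonConst, one_div,
      inv_mul_cancel₀ (jacksonConst_pos hn r).ne']

end Kernels

section Operators

variable {I I₀ q : ℍ[ℝ]} {κ : ℝ → ℝ} {a b : ℕ → ℍ[ℝ]} {f g : ℍ[ℝ] → ℍ[ℝ]} {n : ℕ}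

lemma fejerOp_eq_rotationMean (I₀ : ℍ[ℝ]) (n : ℕ) (f : ℍ[ℝ] → ℍ[ℝ]) (q : ℍ[ℝ]) :
    fejerOp I₀ n f q = rotationMean (fejerKernel n) 1 (imagUnit I₀ q) f q := by
  simp only [fejerOp, rotationMean, Nat.cast_one, one_mul]

lemma HasPowerSeries.map_fejerOp (hf : HasPowerSeries a f) (hI₀ : I₀ ∈ imagSphere) (hn : n ≠ 0) :
    HasPowerSeries (fun j => (((n - j : ℕ) : ℝ) / n) • a j) (fejerOp I₀ n f) := fun q => by
  have hκ := isAveragingKernel_fejerKernel hn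
  simpa only [mul_one, cosMoment_fejerKernel hn, ← fejerOp_eq_rotationMean] using
    hf.rotationMean_imagUnit hκ.intervalIntegrable hκ.even 1 hI₀ q

/-- With truncated subtraction, the multiplier `((2 n - j) - (n - j)) / n` is `1` for `j ≤ n`,
decreases linearly for `n ≤ j ≤ 2 n`, and vanishes from there on. -/
lemma HasPowerSeries.map_valleePoussinOp (hf : HasPowerSeries a f) (hI₀ : I₀ ∈ imagSphere)
    (hn : n ≠ 0) :
    HasPowerSeries (fun j => ((((2 * n - j : ℕ) : ℝ) - (n - j : ℕ)) / n) • a j)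
      (valleePoussinOp I₀ n f) := fun q => by
  refine (((hf.map_fejerOp hI₀ (mul_ne_zero two_ne_zero hn) q).const_smul (2 : ℝ)).sub
    (hf.map_fejerOp hI₀ hn q)).congr_fun fun j => ?_
  rw [← mul_smul_comm, smul_smul, ← mul_sub, ← sub_smul]
  congr 2
  push_cast
  field_simp

lemma HasPowerSeries.valleePoussinOp_mem_polysDegreeLE (hf : HasPowerSeries a f)
    (hI₀ : I₀ ∈ imagSphere) (hn : n ≠ 0) :
    valleePoussinOp I₀ n f ∈ polysDegreeLE (2 * n - 1) :=
  (hf.map_valleePoussinOp hI₀ hn).mem_polysDegreeLE fun j hj => by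
    rw [Nat.sub_eq_zero_of_le (by lia : 2 * n ≤ j), Nat.sub_eq_zero_of_le (by lia : n ≤ j),
      sub_self, zero_div, zero_smul]

lemma HasPowerSeries.valleePoussinOp_sub (hf : HasPowerSeries a f) (hg : HasPowerSeries b g)
    (hI₀ : I₀ ∈ imagSphere) (hn : n ≠ 0) :
    valleePoussinOp I₀ n (f - g)
      = valleePoussinOp I₀ n f - valleePoussinOp I₀ n g := by
  refine ((hf.sub hg).map_valleePoussinOp hI₀ hn).unique ?_
  simpa only [Pi.sub_def, smul_sub] using
    (hf.map_valleePoussinOp hI₀ hn).sub (hg.map_valleePoussinOp hI₀ hn)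

lemma valleePoussinOp_of_mem_polysDegreeLE (hI₀ : I₀ ∈ imagSphere) (hn : n ≠ 0)
    (hf : f ∈ polysDegreeLE n) : valleePoussinOp I₀ n f = f := by
  obtain ⟨a, ha, hzero⟩ := exists_hasPowerSeries_of_mem_polysDegreeLE hf
  refine (ha.map_valleePoussinOp hI₀ hn).unique ?_
  convert ha using 2 with j
  rcases le_or_gt j n with hj | hj
  · rw [Nat.cast_sub hj, Nat.cast_sub (by lia), Nat.cast_mul, Nat.cast_two,
      sub_sub_sub_cancel_right, two_mul, add_sub_cancel_right, div_self (Nat.cast_ne_zero.2 hn),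
      one_smul]
  · rw [hzero j hj, smul_zero]

lemma integral_smul_sum_eq_sum_rotationMean (hκ : IntervalIntegrable κ volume (-π) π)
    (hf : Continuous f) (s : Finset ℕ) (c : ℕ → ℝ) (I q : ℍ[ℝ]) :
    ∫ t in (-π)..π, κ t • ∑ k ∈ s, c k • f (q * expUnit I (k * t))
      = ∑ k ∈ s, c k • rotationMean κ k I f q := by
  have hexp : Continuous (expUnit I) := continuous_expUnit I
  have hint (k : ℕ) :
      IntervalIntegrable (fun t => c k • κ t • f (q * expUnit I (k * t))) volume (-π) π :=
    (hκ.smul_continuousOn (Continuous.continuousOn (by fun_prop))).smul (c k)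
  simp only [Finset.smul_sum, smul_comm (κ _), rotationMean,
    intervalIntegral.integral_finsetSum fun k _ => hint k, intervalIntegral.integral_smul]

lemma jacksonOp_eq_sum_rotationMean (hf : Continuous f) (hn : n ≠ 0) (I₀ : ℍ[ℝ]) (m r : ℕ)
    (q : ℍ[ℝ]) :
    jacksonOp I₀ n m r f q = -∑ k ∈ Finset.Icc 1 (m + 1),
      ((-1 : ℝ) ^ k * ((m + 1).choose k : ℝ)) •
        rotationMean (jacksonKernel n r) k (imagUnit I₀ q) f q := by
  rw [jacksonOp, integral_smul_sum_eq_sum_rotationMean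
    (isAveragingKernel_jacksonKernel hn r).intervalIntegrable hf]

lemma HasPowerSeries.jacksonOp_mem_polysDegreeLE (hf : HasPowerSeries a f)
    (hI₀ : I₀ ∈ imagSphere) (hn : n ≠ 0) (m r : ℕ) :
    jacksonOp I₀ n m r f ∈ polysDegreeLE (r * (n - 1)) := by
  have hκ := isAveragingKernel_jacksonKernel hn r
  have hJ : HasPowerSeries (fun j => -∑ k ∈ Finset.Icc 1 (m + 1),
      ((-1 : ℝ) ^ k * ((m + 1).choose k : ℝ)) • cosMoment (jacksonKernel n r) (j * k) • a j)
      (jacksonOp I₀ n m r f) := fun q => by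
    rw [jacksonOp_eq_sum_rotationMean hf.continuous hn]
    simpa only [mul_neg, Finset.mul_sum, mul_smul_comm] using
      (hasSum_sum fun k (_ : k ∈ Finset.Icc 1 (m + 1)) =>
        (hf.rotationMean_imagUnit hκ.intervalIntegrable hκ.even k hI₀ q).const_smul
          ((-1 : ℝ) ^ k * ((m + 1).choose k : ℝ))).neg
  refine hJ.mem_polysDegreeLE fun j hj => neg_eq_zero.2 (Finset.sum_eq_zero fun k hk => ?_)
  rw [cosMoment_jacksonKernel_eq_zero
    (hj.trans_le (Nat.le_mul_of_pos_right j (Finset.mem_Icc.1 hk).1)), zero_smul, smul_zero]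

/-- The term `s = 0` of the rotational difference is `± f q`, because the kernel has mass one. -/
lemma HasPowerSeries.jacksonOp_sub_eq_integral (hf : HasPowerSeries a f) (hI₀ : I₀ ∈ imagSphere)
    (hI : I ∈ imagSphere) (hq : q ∈ Set.range (slicePoint I)) (hn : n ≠ 0) (m r : ℕ) :
    jacksonOp I₀ n m r f q - f q
      = (-1 : ℝ) ^ m • ∫ t in (-π)..π, jacksonKernel n r t • rotDiff I (m + 1) t f q := by
  have hκ := isAveragingKernel_jacksonKernel hn r
  have hzero : rotationMean (jacksonKernel n r) 0 I f q = f q := by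
    simp [rotationMean, expUnit, intervalIntegral.integral_smul_const, hκ.integral_eq_one]
  have hsign (s : ℕ) : (-1 : ℝ) ^ m * ((-1) ^ (m + 1 + s) * (m + 1).choose s)
      = -((-1) ^ s * (m + 1).choose s) := by
    rw [← mul_assoc, ← pow_add, show m + (m + 1 + s) = 2 * m + 1 + s by ring, pow_add,
      Odd.neg_one_pow ⟨m, rfl⟩, neg_one_mul, neg_mul]
  simp only [rotDiff]
  rw [jacksonOp_eq_sum_rotationMean hf.continuous hn,
    integral_smul_sum_eq_sum_rotationMean hκ.intervalIntegrable hf.continuous, Finset.smul_sum,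
    Finset.sum_range_eq_add_Ico _ (by lia)]
  simp only [smul_smul, hsign, neg_smul, Finset.sum_neg_distrib, hzero,
    hf.rotationMean_imagUnit_eq hκ.intervalIntegrable hκ.even _ hI₀ hI hq]
  simp only [sub_eq_neg_add, pow_zero, Nat.choose_zero_right, Nat.cast_one, mul_one, one_smul,
    add_right_inj, neg_inj]
  rfl

end Operators

section LpEstimates

lemma funLeft_pow {R M X : Type*} [Semiring R] [AddCommMonoid M] [Module R M] (T : X → X) (i : ℕ) :
    (LinearMap.funLeft R M T : Module.End R (X → M)) ^ i = LinearMap.funLeft R M T^[i] := by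
  induction i with
  | zero => rfl
  | succ i ih => rw [pow_succ', ih, Function.iterate_succ]; rfl

variable {X E : Type*} [MeasurableSpace X] [NormedAddCommGroup E] [NormedSpace ℝ E]
  {μ : Measure X}

lemma rpow_enorm_integral_le [IsProbabilityMeasure μ] {p : ℝ} (hp : 1 ≤ p)
    {g : X → E} (hg : AEStronglyMeasurable g μ) :
    ‖∫ x, g x ∂μ‖ₑ ^ p ≤ ∫⁻ x, ‖g x‖ₑ ^ p ∂μ := by
  have hp0 : 0 < p := zero_lt_one.trans_le hp
  have hmean : ∫⁻ x, ‖g x‖ₑ ∂μ ≤ (∫⁻ x, ‖g x‖ₑ ^ p ∂μ) ^ (1 / p) := by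
    simpa only [eLpNorm'_eq_lintegral_enorm, ENNReal.rpow_one, div_one] using
      eLpNorm'_le_eLpNorm'_of_exponent_le zero_lt_one hp μ hg
  calc ‖∫ x, g x ∂μ‖ₑ ^ p ≤ ((∫⁻ x, ‖g x‖ₑ ^ p ∂μ) ^ (1 / p)) ^ p := by
        gcongr
        exact (enorm_integral_le_lintegral_enorm g).trans hmean
    _ = ∫⁻ x, ‖g x‖ₑ ^ p ∂μ := by
        rw [← ENNReal.rpow_mul, one_div_mul_cancel hp0.ne', ENNReal.rpow_one]

lemma lintegral_rpow_enorm_integral_le {Y : Type*} [MeasurableSpace Y]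
    {ν : Measure Y} [SFinite μ] [IsProbabilityMeasure ν] {p : ℝ} (hp : 1 ≤ p) {G : Y → X → E}
    (hG : StronglyMeasurable (Function.uncurry G)) :
    ∫⁻ x, ‖∫ y, G y x ∂ν‖ₑ ^ p ∂μ ≤ ∫⁻ y, ∫⁻ x, ‖G y x‖ₑ ^ p ∂μ ∂ν :=
  calc ∫⁻ x, ‖∫ y, G y x ∂ν‖ₑ ^ p ∂μ ≤ ∫⁻ x, ∫⁻ y, ‖G y x‖ₑ ^ p ∂ν ∂μ :=
        lintegral_mono fun x => rpow_enorm_integral_le hp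
          (hG.comp_measurable (measurable_prodMk_right (y := x))).aestronglyMeasurable
    _ = ∫⁻ y, ∫⁻ x, ‖G y x‖ₑ ^ p ∂μ ∂ν :=
        lintegral_lintegral_swap
          ((hG.comp_measurable measurable_swap).enorm.pow_const p).aemeasurable

lemma measurePreserving_withDensity {T : X → X} (hT : MeasurePreserving T μ μ) {w : X → ℝ≥0∞}
    (hw : Measurable w) (hwT : ∀ x, w (T x) = w x) :
    MeasurePreserving T (μ.withDensity w) (μ.withDensity w) :=
  ⟨hT.measurable, Measure.ext fun s hs => by
    rw [Measure.map_apply hT.measurable hs, withDensity_apply _ hs,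
      withDensity_apply _ (hT.measurable hs), ← hT.setLIntegral_comp_preimage hs hw]
    simp only [hwT]⟩

lemma eLpNorm_pow_apply_le {p c : ℝ≥0∞} {A : Module.End ℝ (X → E)}
    (hA : ∀ u, AEStronglyMeasurable u μ →
      AEStronglyMeasurable (A u) μ ∧ eLpNorm (A u) p μ ≤ c * eLpNorm u p μ)
    (k : ℕ) {u : X → E} (hu : AEStronglyMeasurable u μ) :
    AEStronglyMeasurable ((A ^ k) u) μ ∧ eLpNorm ((A ^ k) u) p μ ≤ c ^ k * eLpNorm u p μ := by
  induction k with
  | zero => simpa using hu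
  | succ k ih =>
    rw [pow_succ', Module.End.mul_apply, pow_succ', mul_assoc]
    exact ⟨(hA _ ih.1).1, (hA _ ih.1).2.trans (by gcongr; exact ih.2)⟩

/-- `U ^ j - 1 = (∑_{i < j} U ^ i) (U - 1)`, and `U` is an isometry. -/
lemma eLpNorm_funLeft_pow_sub_one_pow_le {T : X → X}
    (hT : MeasurePreserving T μ μ) {p : ℝ≥0∞} (hp : 1 ≤ p) (j k : ℕ) {u : X → E}
    (hu : AEStronglyMeasurable u μ) :
    eLpNorm (((LinearMap.funLeft ℝ E T ^ j - 1 : Module.End ℝ (X → E)) ^ k) u) p μ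
      ≤ j ^ k * eLpNorm (((LinearMap.funLeft ℝ E T - 1 : Module.End ℝ (X → E)) ^ k) u) p μ := by
  set U : Module.End ℝ (X → E) := LinearMap.funLeft ℝ E T
  have hpow (i : ℕ) {v : X → E} (hv : AEStronglyMeasurable v μ) :
      AEStronglyMeasurable ((U ^ i) v) μ ∧ eLpNorm ((U ^ i) v) p μ = eLpNorm v p μ := by
    rw [funLeft_pow]
    exact ⟨hv.comp_measurePreserving (hT.iterate i),
      eLpNorm_comp_measurePreserving hv (hT.iterate i)⟩
  have hdiff {v : X → E} (hv : AEStronglyMeasurable v μ) : AEStronglyMeasurable ((U - 1) v) μ := by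
    simpa using (hpow 1 hv).1.sub hv
  have hsum (v : X → E) (hv : AEStronglyMeasurable v μ) :
      AEStronglyMeasurable ((∑ i ∈ Finset.range j, U ^ i) v) μ ∧
        eLpNorm ((∑ i ∈ Finset.range j, U ^ i) v) p μ ≤ j * eLpNorm v p μ := by
    rw [LinearMap.sum_apply]
    refine ⟨Finset.aestronglyMeasurable_sum _ fun i _ => (hpow i hv).1,
      (eLpNorm_sum_le (fun i _ => (hpow i hv).1) hp).trans_eq ?_⟩
    simp only [(hpow _ hv).2, Finset.sum_const, Finset.card_range, nsmul_eq_mul]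
  have hmeas : AEStronglyMeasurable (((U - 1) ^ k) u) μ := by
    induction k with
    | zero => simpa using hu
    | succ k ih => rw [pow_succ', Module.End.mul_apply]; exact hdiff ih
  have hcomm : Commute (∑ i ∈ Finset.range j, U ^ i) (U - 1) := by
    rw [Commute, SemiconjBy, geom_sum_mul, mul_geom_sum]
  rw [← geom_sum_mul, hcomm.mul_pow, Module.End.mul_apply]
  exact (eLpNorm_pow_apply_le hsum k hmeas).2

end LpEstimates

section WeightedEstimates

variable {α p : ℝ} {I : ℍ[ℝ]} {κ : ℝ → ℝ} {f : ℍ[ℝ] → ℍ[ℝ]}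

/-- The measure `(e^{-α |z|² / 2})^p dA(z)`, so that `weightedIntegral` is the `p`-th power of an
`L^p` norm. -/
def weightMeasure (α p : ℝ) : Measure ℂ :=
  volume.withDensity fun z => ENNReal.ofReal (exp (-α * ‖z‖ ^ 2 / 2)) ^ p

instance (α p : ℝ) : SFinite (weightMeasure α p) := by unfold weightMeasure; infer_instance

/-- The weighted `L^p` norm of `f` on the slice `ℂ_I`: the norm `fockNorm` without its normalizing
factor. -/
def sliceNorm (α p : ℝ) (I : ℍ[ℝ]) (f : ℍ[ℝ] → ℍ[ℝ]) : ℝ≥0∞ :=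
  eLpNorm (fun z => f (slicePoint I z)) (ENNReal.ofReal p) (weightMeasure α p)

lemma weightedIntegral_eq_lintegral (hp : 0 < p) (α : ℝ) (g : ℂ → ℍ[ℝ]) :
    weightedIntegral α p g = ∫⁻ z, ‖g z‖ₑ ^ p ∂weightMeasure α p := by
  rw [weightMeasure, lintegral_withDensity_eq_lintegral_mul_non_measurable _ (by fun_prop)
    (.of_forall fun z => ENNReal.rpow_lt_top_of_nonneg hp.le ENNReal.ofReal_ne_top)]
  simp only [weightedIntegral, Pi.mul_apply, mul_comm]

lemma weightedIntegral_rpow_eq_sliceNorm (hp : 0 < p) (α : ℝ) (I : ℍ[ℝ]) (f : ℍ[ℝ] → ℍ[ℝ]) :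
    weightedIntegral α p (fun z => f (slicePoint I z)) ^ (1 / p) = sliceNorm α p I f := by
  rw [sliceNorm, eLpNorm_eq_lintegral_rpow_enorm_toReal (by simpa using hp) ENNReal.ofReal_ne_top,
    ENNReal.toReal_ofReal hp.le, weightedIntegral_eq_lintegral hp]

lemma fockNorm_eq_mul_sliceNorm (hp : 0 < p) (α : ℝ) (I : ℍ[ℝ]) (f : ℍ[ℝ] → ℍ[ℝ]) :
    fockNorm α p I f = ENNReal.ofReal (α * p / (2 * π)) ^ (1 / p) * sliceNorm α p I f := by
  rw [fockNorm, ENNReal.mul_rpow_of_nonneg _ _ (by positivity),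
    weightedIntegral_rpow_eq_sliceNorm hp]

lemma sliceNorm_rotDiff_le_modulus (hp : 0 < p) (α : ℝ) (I : ℍ[ℝ]) (k : ℕ) (f : ℍ[ℝ] → ℍ[ℝ])
    {h δ : ℝ} (hh : |h| ≤ δ) : sliceNorm α p I (rotDiff I k h f) ≤ modulus α p I k f δ := by
  rw [← weightedIntegral_rpow_eq_sliceNorm hp]
  exact le_iSup₂ (f := fun (h : ℝ) (_ : |h| ≤ δ) =>
    weightedIntegral α p (fun z => rotDiff I k h f (slicePoint I z)) ^ (1 / p)) h hh

/-- The measure on `(-π, π]` with density `κ`. -/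
def kernelMeasure (κ : ℝ → ℝ) : Measure ℝ :=
  (volume.restrict (Set.Ioc (-π) π)).withDensity fun t => ENNReal.ofReal (κ t)

lemma IsAveragingKernel.isProbabilityMeasure (hκ : IsAveragingKernel κ) :
    IsProbabilityMeasure (kernelMeasure κ) := ⟨by
  rw [kernelMeasure, withDensity_apply _ MeasurableSet.univ, Measure.restrict_univ,
    ← ofReal_integral_eq_lintegral_ofReal hκ.intervalIntegrable.1 (.of_forall hκ.nonneg),
    ← intervalIntegral.integral_of_le (neg_lt_self pi_pos).le, hκ.integral_eq_one,
    ENNReal.ofReal_one]⟩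

lemma IsAveragingKernel.integral_kernelMeasure {E : Type*} [NormedAddCommGroup E]
    [NormedSpace ℝ E] (hκ : IsAveragingKernel κ) (g : ℝ → E) :
    ∫ t, g t ∂kernelMeasure κ = ∫ t in (-π)..π, κ t • g t := by
  rw [kernelMeasure, integral_withDensity_eq_integral_toReal_smul hκ.measurable.ennreal_ofReal
    (.of_forall fun t => ENNReal.ofReal_lt_top),
    intervalIntegral.integral_of_le (neg_lt_self pi_pos).le]
  simp only [ENNReal.toReal_ofReal (hκ.nonneg _)]

lemma sliceNorm_integral_rpow_le (hp : 1 ≤ p) (hκ : IsAveragingKernel κ) (α : ℝ) (I : ℍ[ℝ])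
    {G : ℝ → ℍ[ℝ] → ℍ[ℝ]} (hG : Continuous (Function.uncurry G)) :
    sliceNorm α p I (fun q => ∫ t in (-π)..π, κ t • G t q) ^ p
      ≤ ∫⁻ t, sliceNorm α p I (G t) ^ p ∂kernelMeasure κ := by
  have hp0 : 0 < p := zero_lt_one.trans_le hp
  have hrpow (g : ℍ[ℝ] → ℍ[ℝ]) :
      sliceNorm α p I g ^ p = ∫⁻ z, ‖g (slicePoint I z)‖ₑ ^ p ∂weightMeasure α p := by
    rw [← weightedIntegral_rpow_eq_sliceNorm hp0, ← ENNReal.rpow_mul, one_div_mul_cancel hp0.ne',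
      ENNReal.rpow_one, weightedIntegral_eq_lintegral hp0]
  have := hκ.isProbabilityMeasure
  simp only [hrpow, ← hκ.integral_kernelMeasure]
  have hslice : Continuous fun x : ℝ × ℂ => G x.1 (slicePoint I x.2) :=
    hG.comp (continuous_fst.prodMk ((continuous_slicePoint I).comp continuous_snd))
  exact lintegral_rpow_enorm_integral_le hp (G := fun t z => G t (slicePoint I z))
    hslice.stronglyMeasurable

lemma measurePreserving_mul_exp (α p t : ℝ) :
    MeasurePreserving (fun z : ℂ => z * Complex.exp (t * Complex.I)) (weightMeasure α p)
      (weightMeasure α p) := by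
  have hrotation : (fun z : ℂ => z * Complex.exp (t * Complex.I)) = rotation (Circle.exp t) := by
    funext z
    rw [rotation_apply, Circle.coe_exp, mul_comm]
  refine measurePreserving_withDensity (hrotation ▸ (rotation (Circle.exp t)).measurePreserving)
    (by fun_prop) fun z => ?_
  rw [norm_mul, Complex.norm_exp_ofReal_mul_I, mul_one]

lemma sliceNorm_comp_mul_expUnit (α p : ℝ) (hI : I ∈ imagSphere) (hf : Continuous f) (t : ℝ) :
    sliceNorm α p I (fun q => f (q * expUnit I t)) = sliceNorm α p I f := by
  simp only [sliceNorm, slicePoint_mul_expUnit hI]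
  exact eLpNorm_comp_measurePreserving (g := fun z => f (slicePoint I z))
    (hf.comp (continuous_slicePoint I)).aestronglyMeasurable (measurePreserving_mul_exp α p t)

/-- A mean of rotations is a mean of isometric copies. -/
lemma sliceNorm_rotationMean_le (hp : 1 ≤ p) (hκ : IsAveragingKernel κ) (α : ℝ)
    (hI : I ∈ imagSphere) (hf : Continuous f) (k : ℕ) :
    sliceNorm α p I (rotationMean κ k I f) ≤ sliceNorm α p I f := by
  have hexp : Continuous (expUnit I) := continuous_expUnit I
  have := hκ.isProbabilityMeasure
  refine (ENNReal.rpow_le_rpow_iff (zero_lt_one.trans_le hp)).1 ?_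
  refine (sliceNorm_integral_rpow_le hp hκ α I
    (G := fun t q => f (q * expUnit I (k * t))) (by fun_prop)).trans_eq ?_
  simp only [sliceNorm_comp_mul_expUnit α p hI hf, lintegral_const, measure_univ, mul_one]

/-- Composition with the rotation `z ↦ z e^{i h}` of a slice. -/
def rotate (h : ℝ) : Module.End ℝ (ℂ → ℍ[ℝ]) :=
  LinearMap.funLeft ℝ ℍ[ℝ] fun z => z * Complex.exp (h * Complex.I)

lemma rotate_pow (h : ℝ) (j : ℕ) : rotate h ^ j = rotate (j * h) := by
  rw [rotate, funLeft_pow, mul_right_iterate, ← Complex.exp_nat_mul, rotate]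
  push_cast
  simp only [mul_assoc]

lemma rotDiff_slicePoint (hI : I ∈ imagSphere) (k : ℕ) (h : ℝ) (f : ℍ[ℝ] → ℍ[ℝ]) :
    (fun z => rotDiff I k h f (slicePoint I z))
      = ((rotate h - 1) ^ k) fun z => f (slicePoint I z) := by
  have hbinomial : (rotate h - 1) ^ k
      = ∑ s ∈ Finset.range (k + 1), ((-1 : ℝ) ^ (k + s) * k.choose s) • rotate (s * h) := by
    have hpoly := congrArg (Polynomial.aeval (rotate h)) (sub_pow (Polynomial.X : ℝ[X]) 1 k)
    simp only [map_pow, map_sub, map_sum, map_mul, map_neg, map_one, one_pow, mul_one, map_natCast,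
      Polynomial.aeval_X, rotate_pow] at hpoly
    rw [hpoly]
    refine Finset.sum_congr rfl fun s _ => ?_
    rw [← Nat.cast_comm, ← mul_assoc, Algebra.smul_def, map_mul, map_pow, map_neg, map_one,
      map_natCast, add_comm s k, Nat.cast_comm ((k.choose s))]
  rw [hbinomial]
  funext z
  simp only [rotDiff, LinearMap.sum_apply, Finset.sum_apply, slicePoint_mul_expUnit hI]
  rfl

lemma sliceNorm_rotDiff_natCast_mul_le (hp : 1 ≤ p) (α : ℝ) (hI : I ∈ imagSphere)
    (hf : Continuous f) (j k : ℕ) (h : ℝ) :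
    sliceNorm α p I (rotDiff I k (j * h) f) ≤ j ^ k * sliceNorm α p I (rotDiff I k h f) := by
  simp only [sliceNorm, rotDiff_slicePoint hI, ← rotate_pow]
  exact eLpNorm_funLeft_pow_sub_one_pow_le (measurePreserving_mul_exp α p h)
    (ENNReal.one_le_ofReal.2 hp) j k (hf.comp (continuous_slicePoint I)).aestronglyMeasurable

/-- Divide the angle `t` into `⌊|t| / δ⌋ + 1` steps, each of size at most `δ`. -/
lemma sliceNorm_rotDiff_le (hp : 1 ≤ p) (α : ℝ) (hI : I ∈ imagSphere) (hf : Continuous f) (k : ℕ)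
    {δ : ℝ} (hδ : 0 < δ) (t : ℝ) :
    sliceNorm α p I (rotDiff I k t f)
      ≤ ENNReal.ofReal ((1 + |t| / δ) ^ k) * modulus α p I k f δ := by
  set j := ⌊|t| / δ⌋₊ + 1 with hj
  have hj0 : (0 : ℝ) < j := by positivity
  have hstep : |t / j| ≤ δ := by
    rw [abs_div, abs_of_pos hj0, div_le_comm₀ hj0 hδ, hj, Nat.cast_add_one]
    exact (Nat.lt_floor_add_one _).le
  have hcount : (j : ℝ) ≤ 1 + |t| / δ := by
    rw [hj, Nat.cast_add_one, add_comm]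
    gcongr
    exact Nat.floor_le (by positivity)
  calc sliceNorm α p I (rotDiff I k t f)
      = sliceNorm α p I (rotDiff I k (j * (t / j)) f) := by rw [mul_div_cancel₀ _ hj0.ne']
    _ ≤ j ^ k * sliceNorm α p I (rotDiff I k (t / j) f) :=
        sliceNorm_rotDiff_natCast_mul_le hp α hI hf j k (t / j)
    _ ≤ ENNReal.ofReal ((1 + |t| / δ) ^ k) * modulus α p I k f δ := by
        rw [ENNReal.ofReal_pow (by positivity), ← ENNReal.ofReal_natCast]
        gcongr
        exact sliceNorm_rotDiff_le_modulus (zero_lt_one.trans_le hp) α I k f hstep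

end WeightedEstimates

section KernelDecay

variable {n : ℕ}

lemma abs_sin_nat_mul_le (n : ℕ) (x : ℝ) : |sin (n * x)| ≤ n * |sin x| := by
  induction n with
  | zero => simp
  | succ n ih =>
    calc |sin ((n + 1 : ℕ) * x)| = |sin (n * x) * cos x + cos (n * x) * sin x| := by
          rw [Nat.cast_add_one, add_one_mul, sin_add]
      _ ≤ |sin (n * x)| * |cos x| + |cos (n * x)| * |sin x| := by
          simpa only [abs_mul] using abs_add_le (sin (n * x) * cos x) (cos (n * x) * sin x)
      _ ≤ n * |sin x| * 1 + 1 * |sin x| := by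
          gcongr <;> exact abs_cos_le_one _
      _ = (n + 1 : ℕ) * |sin x| := by push_cast; ring

lemma abs_sin_div_sin_mul_le (n : ℕ) {t : ℝ} (ht : |t| ≤ π) (hsin : sin (t / 2) ≠ 0) :
    |sin (n * t / 2) / sin (t / 2)| * (1 + n * |t|) ≤ (π + 1) * n := by
  have hnumerator : |sin (n * t / 2)| ≤ n * |sin (t / 2)| := by
    simpa only [mul_div_assoc] using abs_sin_nat_mul_le n (t / 2)
  have hdenominator : |t| ≤ |sin (t / 2)| * π := by
    have h := mul_abs_le_abs_sin (x := t / 2) (by rw [abs_div, abs_two]; linarith)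
    rw [abs_div, abs_two] at h
    rw [← div_le_iff₀ pi_pos]
    exact le_of_eq_of_le (by ring) h
  rw [abs_div, div_mul_eq_mul_div, div_le_iff₀ (abs_pos.2 hsin)]
  calc |sin (n * t / 2)| * (1 + n * |t|)
      = |sin (n * t / 2)| + n * (|sin (n * t / 2)| * |t|) := by ring
    _ ≤ n * |sin (t / 2)| + n * (1 * (|sin (t / 2)| * π)) := by
        gcongr
        exact abs_sin_le_one _
    _ = (π + 1) * n * |sin (t / 2)| := by ring

lemma rpow_le_pow_mul_inv_one_add_sq {x s : ℝ} (hx : 0 ≤ x) {N : ℕ} (hs : s + 2 ≤ N) :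
    (1 + x) ^ s ≤ (1 + x) ^ N * (1 + x ^ 2)⁻¹ := by
  rw [← div_eq_mul_inv, le_div_iff₀ (by positivity)]
  calc (1 + x) ^ s * (1 + x ^ 2) ≤ (1 + x) ^ s * (1 + x) ^ 2 := by gcongr; nlinarith
    _ = (1 + x) ^ (s + 2) := by rw [rpow_add (by positivity), rpow_two]
    _ ≤ (1 + x) ^ (N : ℝ) := rpow_le_rpow_of_exponent_le (by linarith) hs
    _ = (1 + x) ^ N := rpow_natCast _ _

lemma jacksonKernel_mul_rpow_le (hn : n ≠ 0) {r : ℕ} {s : ℝ} (hs : s + 2 ≤ 2 * r) {t : ℝ}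
    (ht : |t| ≤ π) (hsin : sin (t / 2) ≠ 0) :
    jacksonKernel n r t * (1 + n * |t|) ^ s
      ≤ ((π + 1) * π / 2) ^ (2 * r) * (n / π) * (1 + (n * t) ^ 2)⁻¹ := by
  set ρ := |sin (n * t / 2) / sin (t / 2)| with hρ
  have hkernel : jacksonKernel n r t = ρ ^ (2 * r) / jacksonConst n r := by
    rw [jacksonKernel, hρ, (even_two_mul r).pow_abs, one_div_mul_eq_div]
  have hweight := rpow_le_pow_mul_inv_one_add_sq (x := n * |t|) (by positivity) (N := 2 * r)
    (by push_cast; exact hs)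
  rw [hkernel, div_mul_eq_mul_div, div_le_iff₀ (jacksonConst_pos hn r)]
  calc ρ ^ (2 * r) * (1 + n * |t|) ^ s
      ≤ ρ ^ (2 * r) * ((1 + n * |t|) ^ (2 * r) * (1 + (n * |t|) ^ 2)⁻¹) := by gcongr
    _ = (ρ * (1 + n * |t|)) ^ (2 * r) * (1 + (n * t) ^ 2)⁻¹ := by
        rw [mul_pow (n : ℝ) |t|, sq_abs, mul_pow, mul_pow, mul_assoc]
    _ ≤ ((π + 1) * n) ^ (2 * r) * (1 + (n * t) ^ 2)⁻¹ := by
        gcongr ?_ ^ _ * _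
        exact abs_sin_div_sin_mul_le n ht hsin
    _ = ((π + 1) * π / 2) ^ (2 * r) * (n / π) * (1 + (n * t) ^ 2)⁻¹
          * ((2 * n / π) ^ (2 * r) * (π / n)) := by
        rw [show (π + 1) * n = ((π + 1) * π / 2) * (2 * n / π) by field_simp, mul_pow]
        field_simp
    _ ≤ ((π + 1) * π / 2) ^ (2 * r) * (n / π) * (1 + (n * t) ^ 2)⁻¹ * jacksonConst n r := by
        gcongr
        exact le_jacksonConst hn r

lemma integral_inv_one_add_mul_sq_le (hn : n ≠ 0) :
    ∫ t in (-π)..π, (n / π) * (1 + (n * t) ^ 2)⁻¹ ≤ 1 := by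
  rw [intervalIntegral.integral_const_mul,
    intervalIntegral.integral_comp_mul_left (fun x => (1 + x ^ 2)⁻¹) (Nat.cast_ne_zero.2 hn),
    integral_inv_one_add_sq, smul_eq_mul]
  have hupper := arctan_lt_pi_div_two (n * π)
  have hlower := neg_pi_div_two_lt_arctan (n * -π)
  calc n / π * ((n : ℝ)⁻¹ * (arctan (n * π) - arctan (n * -π)))
      ≤ n / π * ((n : ℝ)⁻¹ * π) := by gcongr; linarith
    _ = 1 := by field_simp

lemma lintegral_rpow_kernelMeasure_jacksonKernel_le (hn : n ≠ 0) {r : ℕ} {s : ℝ}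
    (hs : s + 2 ≤ 2 * r) :
    ∫⁻ t, ENNReal.ofReal ((1 + n * |t|) ^ s) ∂kernelMeasure (jacksonKernel n r)
      ≤ ENNReal.ofReal (((π + 1) * π / 2) ^ (2 * r)) := by
  have hκ := isAveragingKernel_jacksonKernel hn r
  have hcont : Continuous fun t : ℝ =>
      ((π + 1) * π / 2) ^ (2 * r) * ((n / π) * (1 + (n * t) ^ 2)⁻¹) :=
    continuous_const.mul (continuous_const.mul (.inv₀ (by fun_prop) fun t => by positivity))
  rw [kernelMeasure, lintegral_withDensity_eq_lintegral_mul _ hκ.measurable.ennreal_ofReal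
    (by fun_prop)]
  calc ∫⁻ t in Set.Ioc (-π) π,
        ENNReal.ofReal (jacksonKernel n r t) * ENNReal.ofReal ((1 + n * |t|) ^ s)
      ≤ ∫⁻ t in Set.Ioc (-π) π, ENNReal.ofReal
          (((π + 1) * π / 2) ^ (2 * r) * ((n / π) * (1 + (n * t) ^ 2)⁻¹)) := by
        refine lintegral_mono_ae ?_
        filter_upwards [ae_restrict_mem measurableSet_Ioc, ae_restrict_of_ae ae_sin_half_ne_zero]
          with t ht hsin
        rw [← ENNReal.ofReal_mul (hκ.nonneg t), ← mul_assoc]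
        exact ENNReal.ofReal_le_ofReal
          (jacksonKernel_mul_rpow_le hn hs (abs_le.2 ⟨ht.1.le, ht.2⟩) hsin)
    _ = ENNReal.ofReal (((π + 1) * π / 2) ^ (2 * r)
          * ∫ t in (-π)..π, (n / π) * (1 + (n * t) ^ 2)⁻¹) := by
        rw [← intervalIntegral.integral_const_mul,
          intervalIntegral.integral_of_le (neg_lt_self pi_pos).le,
          ofReal_integral_eq_lintegral_ofReal (hcont.intervalIntegrable (-π) π).1
            (.of_forall fun t => by simp only [Pi.zero_apply]; positivity)]
    _ ≤ ENNReal.ofReal (((π + 1) * π / 2) ^ (2 * r)) :=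
        ENNReal.ofReal_le_ofReal
          (mul_le_of_le_one_right (by positivity) (integral_inv_one_add_mul_sq_le hn))

end KernelDecay

section Approximation

variable {α p : ℝ} {I I₀ : ℍ[ℝ]} {a : ℕ → ℍ[ℝ]} {f : ℍ[ℝ] → ℍ[ℝ]} {n : ℕ}

lemma sliceNorm_integral_jacksonKernel_smul_rotDiff_le (hp : 1 ≤ p) (α : ℝ) (hI : I ∈ imagSphere)
    (hf : Continuous f) (hn : n ≠ 0) {k r : ℕ} (hr : (p * k + 2) / 2 ≤ r) :
    sliceNorm α p I (fun q => ∫ t in (-π)..π, jacksonKernel n r t • rotDiff I k t f q)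
      ≤ ENNReal.ofReal ((((π + 1) * π / 2) ^ (2 * r)) ^ (1 / p))
        * modulus α p I k f (1 / (n : ℝ)) := by
  have hp0 : 0 < p := zero_lt_one.trans_le hp
  have hexp : Continuous (expUnit I) := continuous_expUnit I
  have hcont : Continuous (Function.uncurry fun t q => rotDiff I k t f q) := by
    unfold rotDiff Function.uncurry
    fun_prop
  have hdiff (t : ℝ) : sliceNorm α p I (rotDiff I k t f) ^ p
      ≤ ENNReal.ofReal ((1 + n * |t|) ^ (p * k)) * modulus α p I k f (1 / (n : ℝ)) ^ p := by
    have h := sliceNorm_rotDiff_le hp α hI hf k (δ := 1 / (n : ℝ)) (by positivity) t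
    rw [div_div_eq_mul_div, div_one, mul_comm |t|] at h
    refine (ENNReal.rpow_le_rpow h hp0.le).trans_eq ?_
    rw [ENNReal.mul_rpow_of_nonneg _ _ hp0.le, ENNReal.ofReal_rpow_of_nonneg (by positivity) hp0.le,
      ← rpow_natCast_mul (by positivity), mul_comm p]
  rw [← ENNReal.ofReal_rpow_of_nonneg (by positivity) (by positivity),
    ← ENNReal.rpow_le_rpow_iff hp0, ENNReal.mul_rpow_of_nonneg _ _ hp0.le, ← ENNReal.rpow_mul,
    one_div_mul_cancel hp0.ne', ENNReal.rpow_one]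
  calc _ ≤ ∫⁻ t, sliceNorm α p I (rotDiff I k t f) ^ p ∂kernelMeasure (jacksonKernel n r) :=
        sliceNorm_integral_rpow_le hp (isAveragingKernel_jacksonKernel hn r) α I hcont
    _ ≤ ∫⁻ t, ENNReal.ofReal ((1 + n * |t|) ^ (p * k)) * modulus α p I k f (1 / (n : ℝ)) ^ p
          ∂kernelMeasure (jacksonKernel n r) := lintegral_mono hdiff
    _ ≤ ENNReal.ofReal (((π + 1) * π / 2) ^ (2 * r)) * modulus α p I k f (1 / (n : ℝ)) ^ p := by
        rw [lintegral_mul_const _ (by fun_prop)]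
        gcongr
        exact lintegral_rpow_kernelMeasure_jacksonKernel_le hn (by linarith)

lemma HasPowerSeries.fockNorm_jacksonOp_sub_le (hf : HasPowerSeries a f) (hα : 0 < α) (hp : 1 ≤ p)
    (hI₀ : I₀ ∈ imagSphere) (hI : I ∈ imagSphere) (hn : n ≠ 0) {m r : ℕ}
    (hr : (p * (m + 1) + 2) / 2 ≤ r) :
    fockNorm α p I (jacksonOp I₀ n m r f - f)
      ≤ ENNReal.ofReal ((((π + 1) * π / 2) ^ (2 * r)) ^ (1 / p) * (α * p / (2 * π)) ^ (1 / p))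
        * modulus α p I (m + 1) f (1 / (n : ℝ)) := by
  have hp0 : 0 < p := zero_lt_one.trans_le hp
  have hsub : sliceNorm α p I (jacksonOp I₀ n m r f - f) = sliceNorm α p I
      (fun q => ∫ t in (-π)..π, jacksonKernel n r t • rotDiff I (m + 1) t f q) := by
    refine eLpNorm_congr_enorm_ae (.of_forall fun z => ?_)
    rw [Pi.sub_apply, hf.jacksonOp_sub_eq_integral hI₀ hI ⟨z, rfl⟩ hn, enorm_smul, enorm_pow,
      enorm_neg, enorm_one, one_pow, one_mul]
  rw [fockNorm_eq_mul_sliceNorm hp0, hsub, mul_comm (_ ^ (1 / p)) (_ ^ (1 / p)),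
    ENNReal.ofReal_mul (by positivity),
    ENNReal.ofReal_rpow_of_nonneg (by positivity) (by positivity), mul_assoc]
  gcongr
  exact sliceNorm_integral_jacksonKernel_smul_rotDiff_le hp α hI hf.continuous hn
    (by push_cast; exact hr)

lemma HasPowerSeries.sliceNorm_fejerOp_le (hf : HasPowerSeries a f) (hp : 1 ≤ p) (α : ℝ)
    (hI₀ : I₀ ∈ imagSphere) (hI : I ∈ imagSphere) (hn : n ≠ 0) :
    sliceNorm α p I (fejerOp I₀ n f) ≤ sliceNorm α p I f := by
  have hκ := isAveragingKernel_fejerKernel hn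
  have hslice (z : ℂ) : fejerOp I₀ n f (slicePoint I z)
      = rotationMean (fejerKernel n) 1 I f (slicePoint I z) := by
    rw [fejerOp_eq_rotationMean,
      hf.rotationMean_imagUnit_eq hκ.intervalIntegrable hκ.even 1 hI₀ hI ⟨z, rfl⟩]
  calc sliceNorm α p I (fejerOp I₀ n f)
      = sliceNorm α p I (rotationMean (fejerKernel n) 1 I f) := by simp only [sliceNorm, hslice]
    _ ≤ sliceNorm α p I f := sliceNorm_rotationMean_le hp hκ α hI hf.continuous 1

lemma sliceNorm_sub_le (hp : 1 ≤ p) (α : ℝ) (I : ℍ[ℝ]) {g : ℍ[ℝ] → ℍ[ℝ]} (hf : Continuous f)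
    (hg : Continuous g) : sliceNorm α p I (f - g) ≤ sliceNorm α p I f + sliceNorm α p I g :=
  eLpNorm_sub_le (hf.comp (continuous_slicePoint I)).aestronglyMeasurable
    (hg.comp (continuous_slicePoint I)).aestronglyMeasurable (ENNReal.one_le_ofReal.2 hp)

lemma HasPowerSeries.sliceNorm_valleePoussinOp_le (hf : HasPowerSeries a f) (hp : 1 ≤ p) (α : ℝ)
    (hI₀ : I₀ ∈ imagSphere) (hI : I ∈ imagSphere) (hn : n ≠ 0) :
    sliceNorm α p I (valleePoussinOp I₀ n f) ≤ 3 * sliceNorm α p I f := by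
  have h2n : 2 * n ≠ 0 := mul_ne_zero two_ne_zero hn
  have hcont {k : ℕ} (hk : k ≠ 0) : Continuous (fejerOp I₀ k f) :=
    (hf.map_fejerOp hI₀ hk).continuous
  calc sliceNorm α p I (valleePoussinOp I₀ n f)
      ≤ sliceNorm α p I ((2 : ℝ) • fejerOp I₀ (2 * n) f)
        + sliceNorm α p I (fejerOp I₀ n f) :=
        sliceNorm_sub_le hp α I ((hcont h2n).const_smul (2 : ℝ)) (hcont hn)
    _ = 2 * sliceNorm α p I (fejerOp I₀ (2 * n) f)
        + sliceNorm α p I (fejerOp I₀ n f) := by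
        congr 1
        exact (eLpNorm_const_smul (2 : ℝ) _ _ _).trans (by simp [Real.enorm_of_nonneg, sliceNorm])
    _ ≤ 2 * sliceNorm α p I f + sliceNorm α p I f := by
        gcongr
        · exact hf.sliceNorm_fejerOp_le hp α hI₀ hI h2n
        · exact hf.sliceNorm_fejerOp_le hp α hI₀ hI hn
    _ = 3 * sliceNorm α p I f := by ring

lemma three_le_two_rpow_mul_rpow (hp : 1 ≤ p) :
    (3 : ℝ) ≤ 2 ^ ((p - 1) / p) * (2 ^ p + 1) ^ (1 / p) := by
  have hp0 : 0 < p := zero_lt_one.trans_le hp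
  have hconvex : (3 : ℝ) ^ p ≤ 2 ^ (p - 1) * (2 ^ p + 1) := by
    have h := NNReal.rpow_add_le_mul_rpow_add_rpow 2 1 hp
    rw [NNReal.one_rpow, show (2 + 1 : NNReal) = 3 by norm_num] at h
    exact_mod_cast h
  calc (3 : ℝ) = ((3 : ℝ) ^ p) ^ (1 / p) := by
        rw [← rpow_mul (by positivity), mul_one_div_cancel hp0.ne', rpow_one]
    _ ≤ (2 ^ (p - 1) * (2 ^ p + 1)) ^ (1 / p) := by gcongr
    _ = 2 ^ ((p - 1) / p) * (2 ^ p + 1) ^ (1 / p) := by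
        rw [mul_rpow (by positivity) (by positivity), ← rpow_mul (by positivity), mul_one_div]

/-- `V_n` fixes polynomials of degree at most `n`, so `V_n f - f = V_n (f - P) - (f - P)`. -/
lemma HasPowerSeries.fockNorm_valleePoussinOp_sub_le (hf : HasPowerSeries a f) (hp : 1 ≤ p) (α : ℝ)
    (hI₀ : I₀ ∈ imagSphere) (hI : I ∈ imagSphere) (hn : n ≠ 0) :
    fockNorm α p I (valleePoussinOp I₀ n f - f)
      ≤ ENNReal.ofReal ((2 : ℝ) ^ ((p - 1) / p) * ((2 : ℝ) ^ p + 1) ^ (1 / p) + 1)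
        * bestApprox α p I n f := by
  have hconst : (4 : ℝ≥0∞)
      ≤ ENNReal.ofReal ((2 : ℝ) ^ ((p - 1) / p) * ((2 : ℝ) ^ p + 1) ^ (1 / p) + 1) :=
    ENNReal.ofNat_le_ofReal.2 (by linarith [three_le_two_rpow_mul_rpow hp])
  have hp0 : 0 < p := zero_lt_one.trans_le hp
  refine le_trans ?_ (mul_le_mul_left hconst _)
  simp only [bestApprox, ENNReal.mul_iInf_of_ne four_ne_zero ENNReal.ofNat_ne_top]
  refine le_iInf₂ fun P hP => ?_
  obtain ⟨b, hb, -⟩ := exists_hasPowerSeries_of_mem_polysDegreeLE hP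
  have hg : HasPowerSeries _ (f - P) := hf.sub hb
  have herror : valleePoussinOp I₀ n f - f
      = valleePoussinOp I₀ n (f - P) - (f - P) := by
    rw [hf.valleePoussinOp_sub hb hI₀ hn, valleePoussinOp_of_mem_polysDegreeLE hI₀ hn hP,
      sub_sub_sub_cancel_right]
  rw [herror, fockNorm_eq_mul_sliceNorm hp0, fockNorm_eq_mul_sliceNorm hp0, mul_left_comm]
  gcongr
  calc _ ≤ sliceNorm α p I (valleePoussinOp I₀ n (f - P)) + sliceNorm α p I (f - P) :=
        sliceNorm_sub_le hp α I (hg.map_valleePoussinOp hI₀ hn).continuous hg.continuous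
    _ ≤ 3 * sliceNorm α p I (f - P) + sliceNorm α p I (f - P) := by
        gcongr
        exact hg.sliceNorm_valleePoussinOp_le hp α hI₀ hI hn
    _ = 4 * sliceNorm α p I (f - P) := by ring

end Approximation

end SliceFock

end

theorem theorem4p5_general (p : ℝ) (hp : 1 ≤ p) :
    (∀ m r : ℕ, (p * (m + 1) + 2) / 2 ≤ r →
      ∃ C : ℝ, 0 < C ∧ ∀ α : ℝ, 0 < α → ∀ f, SliceRegular f →
        ∀ I₀ ∈ imagSphere, ∀ n : ℕ, 1 ≤ n →
          jacksonOp I₀ n m r f ∈ polysDegreeLE (r * (n - 1)) ∧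
          ∀ I ∈ imagSphere,
            fockNorm α p I (jacksonOp I₀ n m r f - f) ≤
              ENNReal.ofReal (C * (α * p / (2 * Real.pi)) ^ (1 / p)) *
                modulus α p I (m + 1) f (1 / (n : ℝ))) ∧
    (∀ α : ℝ, 0 < α → ∀ f, SliceRegular f →
      ∀ I₀ ∈ imagSphere, ∀ n : ℕ, 1 ≤ n →
        valleePoussinOp I₀ n f ∈ polysDegreeLE (2 * n - 1) ∧
        ∀ I ∈ imagSphere,
          fockNorm α p I (valleePoussinOp I₀ n f - f) ≤
            ENNReal.ofReal
              ((2 : ℝ) ^ ((p - 1) / p) * ((2 : ℝ) ^ p + 1) ^ (1 / p) + 1) *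
              bestApprox α p I n f) := by
  refine ⟨fun m r hr => ⟨(((Real.pi + 1) * Real.pi / 2) ^ (2 * r)) ^ (1 / p), by positivity, ?_⟩,
    ?_⟩
  · intro α hα f hf I₀ hI₀ n hn
    obtain ⟨a, ha⟩ := hf.exists_hasPowerSeries hI₀
    have hn0 : n ≠ 0 := Nat.one_le_iff_ne_zero.1 hn
    exact ⟨ha.jacksonOp_mem_polysDegreeLE hI₀ hn0 m r,
      fun I hI => ha.fockNorm_jacksonOp_sub_le hα hp hI₀ hI hn0 hr⟩
  · intro α _ f hf I₀ hI₀ n hn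
    obtain ⟨a, ha⟩ := hf.exists_hasPowerSeries hI₀
    have hn0 : n ≠ 0 := Nat.one_le_iff_ne_zero.1 hn
    exact ⟨ha.valleePoussinOp_mem_polysDegreeLE hI₀ hn0,
      fun I hI => ha.fockNorm_valleePoussinOp_sub_le hp α hI₀ hI hn0⟩

theorem theorem4p5 (p : ℝ) (hp : 1 ≤ p) :
    (∀ m r : ℕ, IsLeast {s : ℕ | (p * ((m : ℝ) + 1) + 2) / 2 ≤ (s : ℝ)} r →
      ∃ C : ℝ, 0 < C ∧ ∀ α : ℝ, 0 < α → ∀ f ∈ fockSlice α p,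
        ∀ I₀ ∈ imagSphere, ∀ n : ℕ, 1 ≤ n →
          jacksonOp I₀ n m r f ∈ polysDegreeLE (r * (n - 1)) ∧
          ∀ I ∈ imagSphere,
            fockNorm α p I (jacksonOp I₀ n m r f - f) ≤
              ENNReal.ofReal (C * (α * p / (2 * Real.pi)) ^ (1 / p)) *
                modulus α p I (m + 1) f (1 / (n : ℝ))) ∧
    (∀ α : ℝ, 0 < α → ∀ f ∈ fockSlice α p,
      ∀ I₀ ∈ imagSphere, ∀ n : ℕ, 1 ≤ n →
        valleePoussinOp I₀ n f ∈ polysDegreeLE (2 * n - 1) ∧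
        ∀ I ∈ imagSphere,
          fockNorm α p I (valleePoussinOp I₀ n f - f) ≤
            ENNReal.ofReal
              ((2 : ℝ) ^ ((p - 1) / p) * ((2 : ℝ) ^ p + 1) ^ (1 / p) + 1) *
              bestApprox α p I n f) :=
  ⟨fun m r hr => ((theorem4p5_general p hp).1 m r hr.1).imp fun _ hC =>
      hC.imp_right fun h α hα f hf => h α hα f hf.1,
    fun α hα f hf => (theorem4p5_general p hp).2 α hα f hf.1⟩
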